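/- **Theorem ($L^p$ decoupling estimates).** Let $\Lambda=(\lambda_j)_{j\ge 0}$ be a strictly increasing sequence of positive real numbers which is quasi-lacunary: there are integers $0=n_0<n_1<n_2<\cdots$, an integer $N\ge 1$ and a real number $q>1$ such that the consecutive blocks $E_k=\{\lambda_j : n_k\le j<n_{k+1}\}$, $k\ge 0$, satisfy $\#E_k\le N$ and $\min E_{k+1}\ge q\,\max E_k$ for all $k\ge 0$. Let $F_k=\operatorname{Span}\{t^{\lambda}:\lambda\in E_k\}$ (with real or complex scalars). Let $p\in[1,\infty)$, $\alpha>-1$ and $\mathrm d\nu_\alpha=(1-x)^\alpha\,\mathrm dx$ on $[0,1]$. Then there exist constants $C_1,C_2>0$, which may depend on $\Lambda$, $(n_k)_{k\ge 0}$, $p$, $\alpha$ and the scalar field, such that for every sequence $(f_k)_{k\ge0}$ with $f_k\in F_k$ for all $k$, $$C_1\Big(\sum_{k}\|f_k\|_{L^p(\mathrm d\nu_\alpha)}^p\Big)^{1/p}\le\Big\|\sum_{k}f_k\Big\|_{L^p(\mathrm d\nu_\alpha)}\le C_2\Big(\sum_{k}\|f_k\|_{L^p(\mathrm d\nu_\alpha)}^p\Big)^{1/p},$$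 where the sums may be taken either over any finite set of indices $k$, or over all $k\ge 0$ whenever the series $\sum_{k\ge 0} f_k$ converges in $L^p(\mathrm d\nu_\alpha)$. Moreover, this series converges in $L^p(\mathrm d\nu_\alpha)$ whenever $\sum_{k\ge0}\|f_k\|_{L^p(\mathrm d\nu_\alpha)}^p<\infty$. -/

import Mathlib

open Filter Topology MeasureTheory
open scoped ENNReal

/-- The `k`-th block of exponents `E_k = {Λ_j : n_k ≤ j < n_{k+1}}`. -/
def expBlock (Λ : ℕ → ℝ) (n : ℕ → ℕ) (k : ℕ) : Set ℝ :=
  Λ '' Set.Ico (n k) (n (k + 1))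

/-- `Λ` is an increasing sequence of positive reals, cut by `0 = n_0 < n_1 < ...` into consecutive
nonempty blocks `E_k` having at most `N` elements, with a multiplicative gap of size at least
`q > 1` between consecutive blocks. -/
structure IsQuasiLacunary (Λ : ℕ → ℝ) (n : ℕ → ℕ) (N : ℕ) (q : ℝ) : Prop where
  strictMono : StrictMono Λ
  pos : ∀ j, 0 < Λ j
  cut_zero : n 0 = 0
  cut_strictMono : StrictMono n
  card_le : ∀ k, (expBlock Λ n k).ncard ≤ N
  one_lt : 1 < q
  gap : ∀ k, ∀ x ∈ expBlock Λ n k, ∀ y ∈ expBlock Λ n (k + 1), q * x ≤ y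

/-- The space `F_k` spanned by the monomials `t ↦ t ^ lam`, `lam ∈ E_k`, with scalars in `𝕜`.
Only the values on `[0, 1]` matter, since all norms below are taken over `[0, 1]`. -/
def blockSpace (𝕜 : Type*) [RCLike 𝕜] (Λ : ℕ → ℝ) (n : ℕ → ℕ) (k : ℕ) : Submodule 𝕜 (ℝ → 𝕜) :=
  Submodule.span 𝕜 ((fun lam : ℝ => fun t : ℝ => ((t ^ lam : ℝ) : 𝕜)) '' expBlock Λ n k)

/-- The measure `(1 - x) ^ α dx` on `[0, 1]`. -/
noncomputable def nuMeasure (α : ℝ) : Measure ℝ :=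
  (volume.restrict (Set.Icc (0 : ℝ) 1)).withDensity fun x => ENNReal.ofReal ((1 - x) ^ α)

/-- The norm of `L^p((1 - x) ^ α dx)`, as an extended nonnegative real. -/
noncomputable def nuNorm {𝕜 : Type*} [RCLike 𝕜] (p α : ℝ) (f : ℝ → 𝕜) : ℝ≥0∞ :=
  eLpNorm f (ENNReal.ofReal p) (nuMeasure α)

/-! Substituting t = e^{-x} turns the elements of F_k into sums of at most N decaying exponentials
on (0, ∞), and ν_α into a weight lying between e^{-(1+|α|)x} x^α and x^α. Cutting the blocks further
at every ratio at least q between consecutive exponents, one may assume that the exponents of a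
block are all comparable to one frequency m_k, with (m_k) lacunary. The general case follows by
applying the refined one both to the whole sum and to each f_k.

A block is rigid at its own scale. The difference g(s + h) - e^{-μh} g(s) removes the exponent μ,
and induction on the number of exponents shows that the mean of |g| over [1, 2], after rescaling,
controls g on [0, ∞) with exponential decay (`norm_expSum_le_integral`). Hence A_k = m_k^{-γ} ∫_1^2
|g_k(u / m_k)| du with γ = (α + 1) / p can stand for the norm of f_k.

Upper bound (`lintegral_rpow_le`): |g_k(x)| is at most a constant times A_k x^{-γ} times a bump in
m_k x. Lacunarity bounds the sum of the bumps, so Jensen's inequality applies, and each bump has the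
same integral against dx / x.

Lower bound (`scaleMean_le`), the heart of the matter: rescale to m_k = 1 and apply a product of
operators f(· + 1) - w f. The values w = e^{-μ}, for μ in the blocks at distance at most M, kill
these blocks; P copies of w = 1 damp the low frequencies; the high ones are already tiny for u ≥ 1.
The block g_k survives because its multipliers stay away from every w. As P is fixed before M, the
gain on far blocks beats the cost of killing the near ones. What remains is a small off-diagonal
interaction, absorbed in ℓ^p by `sum_rpow_le_of_le_add`.

The factor lost in the lower weight is multiplication by e^{-bx} with b = (1 + |α|) / p, that is, a
translation of all exponents by b, which costs only a bounded factor in A_k. Infinite sums follow by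
passing to the limit and by completeness. -/

/-! ### Rigidity of exponential sums with boundedly many exponents -/

section ExpSum
variable {𝕜 : Type*} [RCLike 𝕜]

/-- The exponential sum `∑_{μ ∈ A} c_μ e^{-μ s}`. -/
noncomputable def expSum (A : Finset ℝ) (c : ℝ → 𝕜) (s : ℝ) : 𝕜 :=
  ∑ μ ∈ A, c μ * ((Real.exp (-(μ * s)) : ℝ) : 𝕜)

@[fun_prop]
lemma continuous_expSum (A : Finset ℝ) (c : ℝ → 𝕜) : Continuous (expSum A c) := by
  unfold expSum
  refine continuous_finsetSum _ fun μ _ => ?_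
  exact continuous_const.mul (RCLike.continuous_ofReal.comp (by fun_prop))

lemma expSum_empty (c : ℝ → 𝕜) (s : ℝ) : expSum ∅ c s = 0 := by simp [expSum]

lemma expSum_add_eq (A : Finset ℝ) (c : ℝ → 𝕜) (t s : ℝ) :
    expSum A c (t + s) = expSum A (fun μ => c μ * ((Real.exp (-(μ * t)) : ℝ) : 𝕜)) s := by
  unfold expSum
  refine Finset.sum_congr rfl fun μ _ => ?_
  rw [mul_assoc, ← RCLike.ofReal_mul, ← Real.exp_add]
  congr 3; ring

/-- The first-order difference with multiplier `w` acts diagonally on exponential sums. -/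
lemma expSum_shift_sub (A : Finset ℝ) (c : ℝ → 𝕜) (h w s : ℝ) :
    expSum A c (s + h) - (w : 𝕜) * expSum A c s
      = expSum A (fun μ => c μ * ((Real.exp (-(μ * h)) - w : ℝ) : 𝕜)) s := by
  unfold expSum
  rw [Finset.mul_sum, ← Finset.sum_sub_distrib]
  refine Finset.sum_congr rfl fun μ _ => ?_
  rw [show -(μ * (s + h)) = -(μ * h) + -(μ * s) by ring, Real.exp_add]
  push_cast; ring

/-- This is the induction step of all the estimates below: the multiplier vanishes at a, so one
exponent disappears at the price of one shift. -/
lemma expSum_peel {A : Finset ℝ} {a : ℝ} (ha : a ∉ A) (c : ℝ → 𝕜) (h s : ℝ) :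
    expSum (insert a A) c (s + h) - ((Real.exp (-(a * h)) : ℝ) : 𝕜) * expSum (insert a A) c s
      = expSum A (fun μ => c μ * ((Real.exp (-(μ * h)) - Real.exp (-(a * h)) : ℝ) : 𝕜)) s := by
  rw [expSum_shift_sub]
  unfold expSum
  rw [Finset.sum_insert ha]
  simp

/-- Rescaling the variable. -/
lemma expSum_div {m : ℝ} (hm : m ≠ 0) (A : Finset ℝ) (c : ℝ → 𝕜) (s : ℝ) :
    expSum A c (s / m) = expSum (A.image (· / m)) (fun ν => c (ν * m)) s := by
  unfold expSum
  rw [Finset.sum_image (by intro x _ y _ h; exact (div_left_inj' hm).1 h)]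
  refine Finset.sum_congr rfl fun μ _ => ?_
  simp only [div_mul_cancel₀ _ hm]
  congr 3; field_simp

lemma norm_ofReal_exp (x : ℝ) : ‖((Real.exp x : ℝ) : 𝕜)‖ = Real.exp x := by
  rw [RCLike.norm_ofReal, abs_of_pos (Real.exp_pos x)]

/-- Backward estimate: the value at `0` is controlled by the mean over an interval to the right. -/
lemma norm_expSum_zero_le (𝕜 : Type*) [RCLike 𝕜] (N : ℕ) {R a : ℝ} (hR : 0 ≤ R) (ha : 0 < a) :
    ∃ C : ℝ, 0 ≤ C ∧ ∀ A : Finset ℝ, A.card ≤ N → (∀ μ ∈ A, 0 ≤ μ ∧ μ ≤ R) → ∀ c : ℝ → 𝕜,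
      ‖expSum A c 0‖ ≤ C * ∫ u in a..((2 * N + 1) * a), ‖expSum A c u‖ := by
  induction N with
  | zero =>
    refine ⟨0, le_rfl, fun A hA _ c => ?_⟩
    have : A = ∅ := by simpa using hA
    subst this
    simp [expSum]
  | succ n ih =>
    obtain ⟨C, hC, ih⟩ := ih
    set K : ℝ := a * Real.exp (-(2 * R * a)) with hK
    have hKpos : 0 < K := by positivity
    refine ⟨(1 + 2 * C * a) / K, by positivity, fun A hA hAR c => ?_⟩
    have hna : (0 : ℝ) ≤ n * a := by positivity
    set g := expSum A c with hg
    have hgc : Continuous fun u => ‖g u‖ := (continuous_expSum A c).norm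
    have hint : ∀ x y, IntervalIntegrable (fun u => ‖g u‖) volume x y :=
      fun x y => hgc.intervalIntegrable x y
    set I := ∫ u in a..((2 * ((n + 1 : ℕ) : ℝ) + 1) * a), ‖g u‖ with hI
    have hsub : ∀ x y, a ≤ x → x ≤ y → y ≤ (2 * ((n + 1 : ℕ) : ℝ) + 1) * a →
        ∫ u in x..y, ‖g u‖ ≤ I := by
      intro x y hx hxy hy
      exact intervalIntegral.integral_mono_interval hx hxy hy
        (Eventually.of_forall fun u => norm_nonneg _) (hint _ _)
    have hI0 : 0 ≤ I := intervalIntegral.integral_nonneg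
      (by push_cast; nlinarith) fun u _ => norm_nonneg _
    rcases A.eq_empty_or_nonempty with rfl | ⟨x, hx⟩
    · simp only [hg, expSum_empty, norm_zero]; positivity
    obtain ⟨hx0, hxR⟩ := hAR x hx
    -- For fixed h the peeled sum has n exponents and is a combination of two translates of g; the
    -- window grows by at most 2a. Integrating over h in [a, 2a] then turns the pointwise value ‖g
    -- h‖ into a mean.
    have key : ∀ h ∈ Set.Icc a (2 * a), Real.exp (-(2 * R * a)) * ‖g 0‖ ≤ ‖g h‖ + 2 * C * I := by
      intro h hh
      have hpeel := fun s => expSum_peel (Finset.notMem_erase x A) c h s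
      simp only [Finset.insert_erase hx] at hpeel
      set c' : ℝ → 𝕜 := fun μ => c μ * ((Real.exp (-(μ * h)) - Real.exp (-(x * h)) : ℝ) : 𝕜)
      have hcard : (A.erase x).card ≤ n := by
        rw [Finset.card_erase_of_mem hx]; omega
      have h1 := ih (A.erase x) hcard (fun μ hμ => hAR μ (Finset.mem_of_mem_erase hμ)) c'
      have hE1 : Real.exp (-(x * h)) ≤ 1 := Real.exp_le_one_iff.2 (by nlinarith [hh.1])
      have hE2 : Real.exp (-(2 * R * a)) ≤ Real.exp (-(x * h)) := by
        apply Real.exp_le_exp.2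
        have : x * h ≤ R * (2 * a) := mul_le_mul hxR hh.2 (by linarith [hh.1]) hR
        linarith
      have h2 : ∫ u in a..((2 * n + 1) * a), ‖expSum (A.erase x) c' u‖ ≤
          ∫ u in a..((2 * n + 1) * a), (‖g (u + h)‖ + ‖g u‖) := by
        apply intervalIntegral.integral_mono_on (by nlinarith)
        · exact (continuous_expSum _ _).norm.intervalIntegrable _ _
        · exact ((hgc.comp (continuous_add_const h)).add hgc).intervalIntegrable _ _
        · intro u _
          rw [← hpeel u]
          refine (norm_sub_le _ _).trans ?_
          rw [norm_mul, norm_ofReal_exp]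
          gcongr
          exact mul_le_of_le_one_left (norm_nonneg _) hE1
      have h3 : ∫ u in a..((2 * n + 1) * a), (‖g (u + h)‖ + ‖g u‖) ≤ I + I := by
        rw [intervalIntegral.integral_add (f := fun u => ‖g (u + h)‖)
          ((hgc.comp (continuous_add_const h)).intervalIntegrable _ _) (hint _ _)]
        rw [intervalIntegral.integral_comp_add_right (fun u => ‖g u‖)]
        apply add_le_add
        · apply hsub <;> push_cast <;> nlinarith [hh.1, hh.2]
        · apply hsub <;> push_cast <;> nlinarith [hh.1, hh.2]
      have h4 : ‖expSum (A.erase x) c' 0‖ ≤ 2 * C * I := by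
        calc _ ≤ C * (I + I) := h1.trans (mul_le_mul_of_nonneg_left (h2.trans h3) hC)
          _ = _ := by ring
      have h5 : Real.exp (-(x * h)) * ‖g 0‖ ≤ ‖g h‖ + ‖expSum (A.erase x) c' 0‖ := by
        have := hpeel 0
        rw [zero_add] at this
        rw [← this]
        nth_rewrite 1 [← norm_ofReal_exp (𝕜 := 𝕜)]
        rw [← norm_mul]
        exact norm_le_insert _ _
      calc _ ≤ Real.exp (-(x * h)) * ‖g 0‖ := by gcongr
        _ ≤ _ := by linarith
    have hint2 : ∫ h in a..(2 * a), Real.exp (-(2 * R * a)) * ‖g 0‖ ≤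
        ∫ h in a..(2 * a), (‖g h‖ + 2 * C * I) := by
      apply intervalIntegral.integral_mono_on (by linarith)
      · simp
      · exact (hint _ _).add (by simp)
      · exact key
    rw [intervalIntegral.integral_add (hint _ _) (by simp)] at hint2
    simp only [intervalIntegral.integral_const, smul_eq_mul] at hint2
    have h6 := hsub a (2 * a) le_rfl (by linarith) (by push_cast; nlinarith)
    rw [div_mul_eq_mul_div, le_div_iff₀ hKpos]
    calc ‖g 0‖ * K = (2 * a - a) * (Real.exp (-(2 * R * a)) * ‖g 0‖) := by rw [hK]; ring
      _ ≤ I + (2 * a - a) * (2 * C * I) := hint2.trans (by linarith)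
      _ = _ := by ring

/-- Forward estimate: an exponential sum bounded on an initial interval decays exponentially. -/
lemma norm_expSum_le_exp (𝕜 : Type*) [RCLike 𝕜] (N : ℕ) {r h : ℝ} (hr : 0 < r) (hh : 0 < h) :
    ∃ C : ℝ, 0 ≤ C ∧ ∀ A : Finset ℝ, A.card ≤ N → (∀ μ ∈ A, r ≤ μ) → ∀ (c : ℝ → 𝕜) (G : ℝ),
      (∀ s, 0 ≤ s → s ≤ N * h → ‖expSum A c s‖ ≤ G) →
      ∀ s, 0 ≤ s → ‖expSum A c s‖ ≤ C * Real.exp (-(r / 2 * s)) * G := by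
  induction N with
  | zero =>
    refine ⟨0, le_rfl, fun A hA _ c G _ s _ => ?_⟩
    have : A = ∅ := by simpa using hA
    subst this
    simp [expSum]
  | succ n ih =>
    obtain ⟨C, hC, ih⟩ := ih
    set E := Real.exp (-(r / 2 * h)) with hE
    have hE0 : 0 < E := Real.exp_pos _
    have hE1 : E < 1 := by
      rw [hE, ← Real.exp_zero]
      exact Real.exp_lt_exp.2 (by have := mul_pos hr hh; linarith)
    have hE1' : 0 < 1 - E := by linarith
    -- The recursion along steps of length h is g(s + h) = e^{-xh} g(s) + (shorter sum), where
    -- e^{-xh} ≤ E². Aiming only at decay E per step leaves the room 1 - E for the source term: C'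
    -- is chosen so that E² C' + 2C ≤ C' E, with C' E ≥ 1 for the start.
    set C' := 1 / E + 2 * C / (E * (1 - E)) with hC'
    have hC'0 : 0 ≤ C' := by positivity
    have hC'1 : 1 ≤ C' * E := by
      have : C' * E = 1 + 2 * C / (1 - E) := by rw [hC']; field_simp
      rw [this]; have : 0 ≤ 2 * C / (1 - E) := by positivity
      linarith
    have hC'2 : E * E * C' + 2 * C ≤ C' * E := by
      have : C' * E - E * E * C' = (1 - E) + 2 * C := by rw [hC']; field_simp
      linarith
    refine ⟨C', hC'0, fun A hA hAr c G hG => ?_⟩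
    have hG0 : 0 ≤ G := (norm_nonneg _).trans (hG 0 le_rfl (by positivity))
    rcases A.eq_empty_or_nonempty with rfl | ⟨x, hx⟩
    · intro s _; simp only [expSum_empty, norm_zero]; positivity
    have hpeel := fun s => expSum_peel (Finset.notMem_erase x A) c h s
    simp only [Finset.insert_erase hx] at hpeel
    set c' : ℝ → 𝕜 := fun μ => c μ * ((Real.exp (-(μ * h)) - Real.exp (-(x * h)) : ℝ) : 𝕜)
    have hcard : (A.erase x).card ≤ n := by
      rw [Finset.card_erase_of_mem hx]; omega
    have hxe : Real.exp (-(x * h)) ≤ E * E := by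
      rw [hE, ← Real.exp_add]
      apply Real.exp_le_exp.2
      nlinarith [mul_le_mul_of_nonneg_right (hAr x hx) hh.le]
    have hxe1 : Real.exp (-(x * h)) ≤ 1 := hxe.trans (by nlinarith)
    have hdec := ih (A.erase x) hcard (fun μ hμ => hAr μ (Finset.mem_of_mem_erase hμ)) c' (2 * G) (by
      intro s hs0 hs1
      rw [← hpeel s]
      refine (norm_sub_le _ _).trans ?_
      rw [norm_mul, norm_ofReal_exp]
      have h1 := hG (s + h) (by linarith) (by push_cast; linarith)
      have h2 := hG s hs0 (by push_cast; linarith)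
      have := mul_le_of_le_one_left (norm_nonneg (expSum A c s)) hxe1
      linarith)
    have main : ∀ j : ℕ, ∀ s, 0 ≤ s → s ≤ (j + 1) * h →
        ‖expSum A c s‖ ≤ C' * Real.exp (-(r / 2 * s)) * G := by
      have base : ∀ s, 0 ≤ s → s ≤ h → ‖expSum A c s‖ ≤ C' * Real.exp (-(r / 2 * s)) * G := by
        intro s hs0 hs1
        have h1 : 1 ≤ C' * Real.exp (-(r / 2 * s)) := hC'1.trans (by
          gcongr
          exact Real.exp_le_exp.2 (by nlinarith))
        have h2 := hG s hs0 (by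
          have : (0 : ℝ) ≤ n * h := by positivity
          push_cast; linarith)
        exact h2.trans (le_mul_of_one_le_left hG0 h1)
      intro j
      induction j with
      | zero => intro s hs0 hs1; exact base s hs0 (by simpa using hs1)
      | succ j ihj =>
        intro s hs0 hs1
        rcases le_or_gt s h with hsh | hsh
        · exact base s hs0 hsh
        have h1 := ihj (s - h) (by linarith) (by push_cast at hs1; linarith)
        have h2 := hdec (s - h) (by linarith)
        have h3 := hpeel (s - h)
        rw [sub_add_cancel] at h3
        have h4 : ‖expSum A c s‖ ≤ ‖expSum (A.erase x) c' (s - h)‖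
            + Real.exp (-(x * h)) * ‖expSum A c (s - h)‖ := by
          rw [← norm_ofReal_exp (𝕜 := 𝕜), ← norm_mul, ← h3]
          simpa using norm_add_le (expSum A c s - ((Real.exp (-(x * h)) : ℝ) : 𝕜) *
            expSum A c (s - h)) (((Real.exp (-(x * h)) : ℝ) : 𝕜) * expSum A c (s - h))
        set X := Real.exp (-(r / 2 * (s - h))) with hX
        have hXE : Real.exp (-(r / 2 * s)) = X * E := by
          rw [hX, hE, ← Real.exp_add]; congr 1; ring
        have hX0 : 0 < X := Real.exp_pos _
        rw [hXE]
        calc _ ≤ C * X * (2 * G) + E * E * (C' * X * G) :=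
              h4.trans (add_le_add h2 (mul_le_mul hxe h1 (norm_nonneg _) (by positivity)))
          _ = (E * E * C' + 2 * C) * (X * G) := by ring
          _ ≤ (C' * E) * (X * G) := by gcongr
          _ = _ := by ring
    intro s hs
    obtain ⟨j, hj⟩ := exists_nat_ge (s / h)
    refine main j s hs ?_
    rw [div_le_iff₀ hh] at hj
    nlinarith

/-- An exponential sum with at most `N` exponents in `[r, R]` is controlled, with exponential
decay, by its mean over `[1, 2]`. -/
lemma norm_expSum_le_integral (𝕜 : Type*) [RCLike 𝕜] (N : ℕ) {r R : ℝ} (hr : 0 < r) :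
    ∃ C : ℝ, 1 ≤ C ∧ ∀ A : Finset ℝ, A.card ≤ N → (∀ μ ∈ A, r ≤ μ ∧ μ ≤ R) → ∀ c : ℝ → 𝕜,
      ∀ s, 0 ≤ s → ‖expSum A c s‖ ≤
        C * Real.exp (-(r / 2 * s)) * ∫ u in (1 : ℝ)..2, ‖expSum A c u‖ := by
  rcases lt_or_ge R r with hRr | hRr
  · refine ⟨1, le_rfl, fun A _ hA c s _ => ?_⟩
    have : A = ∅ := by
      by_contra hne
      obtain ⟨x, hx⟩ := Finset.nonempty_of_ne_empty hne
      linarith [(hA x hx).1, (hA x hx).2]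
    subst this
    simp [expSum]
  have hR : 0 ≤ R := hr.le.trans hRr
  -- With this step the backward windows started at points of [1, 1 + N a] stay inside [1, 2].
  set a : ℝ := 1 / (2 * (2 * N + 1)) with ha
  have ha0 : 0 < a := by positivity
  have ha2 : (2 * N + 1) * a = 1 / 2 := by rw [ha]; field_simp
  have hN0 : (0 : ℝ) ≤ N := by positivity
  obtain ⟨C₁, hC₁, h₁⟩ := norm_expSum_zero_le 𝕜 N hR ha0
  obtain ⟨C₂, hC₂, h₂⟩ := norm_expSum_le_exp 𝕜 N hr ha0
  obtain ⟨C₃, hC₃, h₃⟩ := norm_expSum_zero_le 𝕜 N hR one_pos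
  set C := 1 + C₂ * C₁ * Real.exp (r / 2) + C₃ * (2 * N * (C₂ * C₁)) * Real.exp (r / 2) with hCdef
  refine ⟨C, by rw [hCdef]; have : 0 ≤ C₂ * C₁ * Real.exp (r / 2) := by positivity
                have : 0 ≤ C₃ * (2 * N * (C₂ * C₁)) * Real.exp (r / 2) := by positivity
                linarith, fun A hA hAr c => ?_⟩
  have hAR : ∀ μ ∈ A, 0 ≤ μ ∧ μ ≤ R := fun μ hμ => ⟨hr.le.trans (hAr μ hμ).1, (hAr μ hμ).2⟩
  set g := expSum A c with hg
  have hgc : Continuous fun u => ‖g u‖ := (continuous_expSum A c).norm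
  set I := ∫ u in (1 : ℝ)..2, ‖g u‖ with hI
  have hI0 : 0 ≤ I := intervalIntegral.integral_nonneg (by norm_num) fun u _ => norm_nonneg _
  have back : ∀ {b C : ℝ}, (∀ A : Finset ℝ, A.card ≤ N → (∀ μ ∈ A, 0 ≤ μ ∧ μ ≤ R) →
      ∀ c : ℝ → 𝕜, ‖expSum A c 0‖ ≤ C * ∫ u in b..((2 * N + 1) * b), ‖expSum A c u‖) →
      ∀ s, ‖g s‖ ≤ C * ∫ u in (s + b)..(s + (2 * N + 1) * b), ‖g u‖ := by
    intro b C hb s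
    have := hb A hA hAR (fun μ => c μ * ((Real.exp (-(μ * s)) : ℝ) : 𝕜))
    simp only [← expSum_add_eq] at this
    rwa [intervalIntegral.integral_comp_add_left (fun u => ‖g u‖), add_zero] at this
  have s1 : ∀ s, 0 ≤ s → s ≤ N * a → ‖g (1 + s)‖ ≤ C₁ * I := by
    intro s hs0 hs1
    refine (back h₁ (1 + s)).trans (mul_le_mul_of_nonneg_left ?_ hC₁)
    refine intervalIntegral.integral_mono_interval (by linarith) (by nlinarith) (by nlinarith)
        (Eventually.of_forall fun u => norm_nonneg _) (hgc.intervalIntegrable _ _)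
  have s2 : ∀ s, 0 ≤ s → ‖g (1 + s)‖ ≤ C₂ * Real.exp (-(r / 2 * s)) * (C₁ * I) := by
    simp only [hg, expSum_add_eq] at s1 ⊢
    exact h₂ A hA (fun μ hμ => (hAr μ hμ).1) _ _ s1
  have s2' : ∀ s, 1 ≤ s → ‖g s‖ ≤ C₂ * C₁ * I := by
    intro s hs
    have := s2 (s - 1) (by linarith)
    rw [add_sub_cancel] at this
    refine this.trans ?_
    have h1 : Real.exp (-(r / 2 * (s - 1))) ≤ 1 := Real.exp_le_one_iff.2 (by nlinarith)
    calc _ ≤ C₂ * 1 * (C₁ * I) := by gcongr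
      _ = _ := by ring
  intro s hs
  rcases le_or_gt 1 s with hs1 | hs1
  · have := s2 (s - 1) (by linarith)
    rw [add_sub_cancel] at this
    have hee : Real.exp (-(r / 2 * (s - 1))) = Real.exp (r / 2) * Real.exp (-(r / 2 * s)) := by
      rw [← Real.exp_add]; congr 1; ring
    rw [hee] at this
    calc _ ≤ _ := this
      _ = (C₂ * C₁ * Real.exp (r / 2)) * Real.exp (-(r / 2 * s)) * I := by ring
      _ ≤ _ := by
        gcongr
        rw [hCdef]
        have : 0 ≤ C₃ * (2 * N * (C₂ * C₁)) * Real.exp (r / 2) := by positivity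
        linarith
  -- To the left of 1, the backward estimate with step 1 uses only values beyond 1, which are
  -- already bounded.
  · have h4 := back h₃ s
    have h5 : ∫ u in (s + 1)..(s + (2 * N + 1) * 1), ‖g u‖ ≤
        ∫ u in (s + 1)..(s + (2 * N + 1) * 1), C₂ * C₁ * I := by
      apply intervalIntegral.integral_mono_on (by linarith) (hgc.intervalIntegrable _ _) (by simp)
      intro u hu
      exact s2' u (by linarith [hu.1])
    rw [intervalIntegral.integral_const, smul_eq_mul] at h5
    have hee : 1 ≤ Real.exp (r / 2) * Real.exp (-(r / 2 * s)) := by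
      rw [← Real.exp_add]; apply Real.one_le_exp; nlinarith
    calc ‖g s‖ ≤ C₃ * (2 * N * (C₂ * C₁)) * I := by
          refine h4.trans ?_
          calc _ ≤ C₃ * ((s + (2 * N + 1) * 1 - (s + 1)) * (C₂ * C₁ * I)) := by gcongr
            _ = _ := by ring
      _ ≤ C₃ * (2 * N * (C₂ * C₁)) * I * (Real.exp (r / 2) * Real.exp (-(r / 2 * s))) :=
          le_mul_of_one_le_right (by positivity) hee
      _ = (C₃ * (2 * N * (C₂ * C₁)) * Real.exp (r / 2)) * Real.exp (-(r / 2 * s)) * I := by ring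
      _ ≤ _ := by
        gcongr
        rw [hCdef]
        have : 0 ≤ C₂ * C₁ * Real.exp (r / 2) := by positivity
        linarith

/-- A Bernstein-type inequality: bounded exponential sums are Lipschitz. -/
lemma norm_expSum_sub_le (𝕜 : Type*) [RCLike 𝕜] (N : ℕ) (R : ℝ) :
    ∃ C : ℝ, 0 ≤ C ∧ ∀ A : Finset ℝ, A.card ≤ N → (∀ μ ∈ A, 0 ≤ μ ∧ μ ≤ R) →
      ∀ (c : ℝ → 𝕜) (G : ℝ), (∀ s, 0 ≤ s → ‖expSum A c s‖ ≤ G) →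
      ∀ s δ, 0 ≤ s → 0 ≤ δ → ‖expSum A c (s + δ) - expSum A c s‖ ≤ C * δ * G := by
  induction N with
  | zero =>
    refine ⟨0, le_rfl, fun A hA _ c G _ s _ _ _ => ?_⟩
    have : A = ∅ := by simpa using hA
    subst this
    simp [expSum]
  | succ n ih =>
    obtain ⟨C, hC, ih⟩ := ih
    refine ⟨(2 * C + 2) * Real.exp R, by positivity, fun A hA hAR c G hG s δ hs hδ => ?_⟩
    have hG0 : 0 ≤ G := (norm_nonneg _).trans (hG 0 le_rfl)
    rcases A.eq_empty_or_nonempty with rfl | ⟨x, hx⟩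
    · simp only [expSum_empty, sub_zero, norm_zero]; positivity
    obtain ⟨hx0, hxR⟩ := hAR x hx
    set g := expSum A c with hg
    have hgc : Continuous g := continuous_expSum A c
    set D : ℝ → 𝕜 := fun h => g (s + δ + h) - g (s + h) with hD
    have hDc : Continuous D := by rw [hD]; fun_prop
    have hcard : (A.erase x).card ≤ n := by
      rw [Finset.card_erase_of_mem hx]; omega
    -- D h - e^{-xh} D 0 is the δ-increment at s of the peeled sum, so the induction hypothesis
    -- applies to it. Integrating over h in [0, 1] isolates D 0, whose coefficient is at least
    -- e^{-R}.
    have step : ∀ h, 0 ≤ h → ‖D h - ((Real.exp (-(x * h)) : ℝ) : 𝕜) * D 0‖ ≤ C * δ * (2 * G) := by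
      intro h hh
      have hpeel := fun s => expSum_peel (Finset.notMem_erase x A) c h s
      simp only [Finset.insert_erase hx] at hpeel
      have hE1 : Real.exp (-(x * h)) ≤ 1 := Real.exp_le_one_iff.2 (by nlinarith)
      have := ih (A.erase x) hcard (fun μ hμ => hAR μ (Finset.mem_of_mem_erase hμ)) _ (2 * G) (by
        intro s hs
        rw [← hpeel s]
        refine (norm_sub_le _ _).trans ?_
        rw [norm_mul, norm_ofReal_exp]
        have h1 := hG (s + h) (by linarith)
        have h2 := mul_le_of_le_one_left (norm_nonneg (expSum A c s)) hE1
        have h3 := hG s hs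
        linarith) s δ hs hδ
      rw [← hpeel, ← hpeel] at this
      convert this using 2
      simp only [hD, ← hg, add_zero]
      ring
    have hlow : Real.exp (-R) ≤ ∫ h in (0 : ℝ)..1, Real.exp (-(x * h)) := by
      have : ∫ h in (0 : ℝ)..1, Real.exp (-R) ≤ ∫ h in (0 : ℝ)..1, Real.exp (-(x * h)) := by
        apply intervalIntegral.integral_mono_on (by norm_num) (by simp)
          ((by fun_prop : Continuous fun h => Real.exp (-(x * h))).intervalIntegrable _ _)
        intro u hu
        apply Real.exp_le_exp.2
        nlinarith [hu.1, hu.2]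
      simpa using this
    have hcoe : Continuous fun h : ℝ => ((Real.exp (-(x * h)) : ℝ) : 𝕜) * D 0 :=
      (RCLike.continuous_ofReal.comp (by fun_prop)).mul continuous_const
    have hnorm : ‖(∫ h in (0 : ℝ)..1, (D h - ((Real.exp (-(x * h)) : ℝ) : 𝕜) * D 0))‖
        ≤ C * δ * (2 * G) := by
      have := intervalIntegral.norm_integral_le_of_norm_le_const (a := (0 : ℝ)) (b := 1)
        (f := fun h => D h - ((Real.exp (-(x * h)) : ℝ) : 𝕜) * D 0) (C := C * δ * (2 * G)) (by
          intro h hh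
          rw [Set.uIoc_of_le (by norm_num)] at hh
          exact step h hh.1.le)
      simpa using this
    have hcast : ∫ h in (0 : ℝ)..1, ((Real.exp (-(x * h)) : ℝ) : 𝕜) =
        ((∫ h in (0 : ℝ)..1, Real.exp (-(x * h)) : ℝ) : 𝕜) := by
      simp only [intervalIntegral.integral_of_le zero_le_one, integral_ofReal]
    rw [intervalIntegral.integral_sub (hDc.intervalIntegrable _ _)
      (hcoe.intervalIntegrable _ _), intervalIntegral.integral_mul_const,
      hcast] at hnorm
    have hDint : ‖∫ h in (0 : ℝ)..1, D h‖ ≤ 2 * (δ * G) := by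
      have hi : ∀ x y, IntervalIntegrable g volume x y := fun x y => hgc.intervalIntegrable x y
      -- The integral of D telescopes to two integrals of g over intervals of length δ, which
      -- supplies the factor δ.
      have e1 : ∫ h in (0 : ℝ)..1, D h = (∫ u in (s + 1)..(s + 1 + δ), g u) -
          ∫ u in s..(s + δ), g u := by
        rw [hD, intervalIntegral.integral_sub
          ((by fun_prop : Continuous fun h => g (s + δ + h)).intervalIntegrable _ _)
          ((by fun_prop : Continuous fun h => g (s + h)).intervalIntegrable _ _),
          intervalIntegral.integral_comp_add_left g, intervalIntegral.integral_comp_add_left g,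
          add_zero, add_zero]
        have := intervalIntegral.integral_add_adjacent_intervals (hi s (s + 1)) (hi (s + 1) (s + 1 + δ))
        have := intervalIntegral.integral_add_adjacent_intervals (hi s (s + δ)) (hi (s + δ) (s + 1 + δ))
        rw [show s + δ + 1 = s + 1 + δ by ring]
        grind
      have e2 : ∀ y, 0 ≤ y → ‖∫ u in y..(y + δ), g u‖ ≤ δ * G := by
        intro y hy
        have := intervalIntegral.norm_integral_le_of_norm_le_const (a := y) (b := y + δ)
          (f := g) (C := G) (by
            intro h hh
            rw [Set.uIoc_of_le (by linarith)] at hh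
            exact hG h (by linarith [hh.1]))
        rw [add_sub_cancel_left, abs_of_nonneg hδ] at this
        linarith
      rw [e1]
      refine (norm_sub_le _ _).trans ?_
      have := e2 s hs
      have := e2 (s + 1) (by linarith)
      linarith
    set J := ∫ h in (0 : ℝ)..1, Real.exp (-(x * h)) with hJ
    have hJ0 : 0 < J := (Real.exp_pos _).trans_le hlow
    have h7 : J * ‖D 0‖ ≤ (2 * C + 2) * δ * G := by
      have : ‖((J : ℝ) : 𝕜) * D 0‖ ≤ ‖∫ h in (0 : ℝ)..1, D h‖ +
          ‖(∫ h in (0 : ℝ)..1, D h) - ((J : ℝ) : 𝕜) * D 0‖ := norm_le_insert _ _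
      rw [norm_mul, RCLike.norm_ofReal, abs_of_pos hJ0] at this
      have e : RCLike.ofReal J = (J : 𝕜) := rfl
      linarith
    have h8 : Real.exp (-R) * ‖D 0‖ ≤ (2 * C + 2) * δ * G :=
      (mul_le_mul_of_nonneg_right hlow (norm_nonneg _)).trans h7
    have h9 : D 0 = g (s + δ) - g s := by simp [hD]
    rw [← h9]
    calc ‖D 0‖ = Real.exp R * (Real.exp (-R) * ‖D 0‖) := by
          rw [← mul_assoc, ← Real.exp_add]; simp
      _ ≤ Real.exp R * ((2 * C + 2) * δ * G) := by gcongr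
      _ = _ := by ring

/-- The first-order difference `g(s + 1) - w g(s)` controls `g` when `w` stays away from
the multipliers of the exponents. -/
lemma norm_expSum_le_of_shift_sub (𝕜 : Type*) [RCLike 𝕜] (N : ℕ) {d : ℝ} (hd : 0 < d) :
    ∃ C : ℝ, 1 ≤ C ∧ ∀ A : Finset ℝ, A.card ≤ N → ∀ w : ℝ,
      (∀ μ ∈ A, 0 ≤ μ ∧ d ≤ |Real.exp (-μ) - w|) → ∀ (c : ℝ → 𝕜) (ε : ℝ),
      (∀ s, 0 ≤ s → ‖expSum A c (s + 1) - (w : 𝕜) * expSum A c s‖ ≤ ε) →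
      ∀ s, 0 ≤ s → ‖expSum A c s‖ ≤ C * ε := by
  induction N with
  | zero =>
    refine ⟨1, le_rfl, fun A hA w _ c ε hε s hs => ?_⟩
    have : A = ∅ := by simpa using hA
    subst this
    have := (norm_nonneg _).trans (hε s hs)
    simpa [expSum] using this
  | succ n ih =>
    obtain ⟨C, hC, ih⟩ := ih
    refine ⟨1 + (1 + 2 * C) / d, by
      have : 0 ≤ (1 + 2 * C) / d := by positivity
      linarith, fun A hA w hw c ε hε s hs => ?_⟩
    have hε0 : 0 ≤ ε := (norm_nonneg _).trans (hε s hs)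
    rcases A.eq_empty_or_nonempty with rfl | ⟨x, hx⟩
    · simp only [expSum_empty, norm_zero]; positivity
    obtain ⟨hx0, hxd⟩ := hw x hx
    have hpeel := fun s => expSum_peel (Finset.notMem_erase x A) c 1 s
    simp only [Finset.insert_erase hx] at hpeel
    have hcard : (A.erase x).card ≤ n := by
      rw [Finset.card_erase_of_mem hx]; omega
    have hE1 : Real.exp (-(x * 1)) ≤ 1 := Real.exp_le_one_iff.2 (by linarith)
    -- Peeling commutes with the operator of multiplier w, so the peeled sum satisfies the same
    -- hypothesis with 2 ε. Subtracting the two differences of g then leaves (e^{-x} - w) g.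
    have h1 := ih (A.erase x) hcard w (fun μ hμ => hw μ (Finset.mem_of_mem_erase hμ)) _ (2 * ε) (by
      intro s hs
      rw [← hpeel, ← hpeel]
      have e : expSum A c (s + 1 + 1) - ((Real.exp (-(x * 1)) : ℝ) : 𝕜) * expSum A c (s + 1) -
          (w : 𝕜) * (expSum A c (s + 1) - ((Real.exp (-(x * 1)) : ℝ) : 𝕜) * expSum A c s)
          = (expSum A c (s + 1 + 1) - (w : 𝕜) * expSum A c (s + 1)) -
            ((Real.exp (-(x * 1)) : ℝ) : 𝕜) * (expSum A c (s + 1) - (w : 𝕜) * expSum A c s) := by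
        ring
      rw [e]
      refine (norm_sub_le _ _).trans ?_
      rw [norm_mul, norm_ofReal_exp]
      have h1 := hε (s + 1) (by linarith)
      have h2 := mul_le_of_le_one_left
        (norm_nonneg (expSum A c (s + 1) - (w : 𝕜) * expSum A c s)) hE1
      have h3 := hε s hs
      linarith) s hs
    rw [← hpeel, mul_one] at h1
    have h2 := hε s hs
    have h3 : ‖((Real.exp (-x) - w : ℝ) : 𝕜) * expSum A c s‖ ≤ C * (2 * ε) + ε := by
      have e : ((Real.exp (-x) - w : ℝ) : 𝕜) * expSum A c s =
          (expSum A c (s + 1) - (w : 𝕜) * expSum A c s) -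
          (expSum A c (s + 1) - ((Real.exp (-x) : ℝ) : 𝕜) * expSum A c s) := by
        push_cast; ring
      rw [e]
      exact (norm_sub_le _ _).trans (by linarith)
    rw [norm_mul, RCLike.norm_ofReal] at h3
    have h4 : d * ‖expSum A c s‖ ≤ C * (2 * ε) + ε :=
      (mul_le_mul_of_nonneg_right hxd (norm_nonneg _)).trans h3
    have h5 : ‖expSum A c s‖ ≤ (1 + 2 * C) / d * ε := by
      rw [div_mul_eq_mul_div, le_div_iff₀ hd]
      linarith
    nlinarith

end ExpSum

/-! ### Lacunary sums and separation of multipliers -/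

section Sequences

lemma sum_pow_dist_le {θ : ℝ} (h0 : 0 ≤ θ) (h1 : θ < 1) (s : Finset ℕ) (k : ℕ) :
    ∑ i ∈ s, θ ^ ((i - k) + (k - i)) ≤ 2 / (1 - θ) := by
  have geo : ∀ t : Finset ℕ, ∑ j ∈ t, θ ^ j ≤ (1 - θ)⁻¹ := fun t => by
    rw [← tsum_geometric_of_lt_one h0 h1]
    exact (summable_geometric_of_lt_one h0 h1).sum_le_tsum t fun i _ => by positivity
  rw [← Finset.sum_filter_add_sum_filter_not s (fun i => k ≤ i)]
  have e1 : ∑ i ∈ s with k ≤ i, θ ^ ((i - k) + (k - i)) ≤ (1 - θ)⁻¹ := by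
    refine le_trans (le_of_eq ?_) (geo ((s.filter (k ≤ ·)).image (· - k)))
    rw [Finset.sum_image]
    · refine Finset.sum_congr rfl fun i hi => ?_
      rw [Finset.mem_filter] at hi
      congr 1; omega
    · intro i hi j hj hij
      simp at hi hj hij
      omega
  have e2 : ∑ i ∈ s with ¬ k ≤ i, θ ^ ((i - k) + (k - i)) ≤ (1 - θ)⁻¹ := by
    refine le_trans (le_of_eq ?_) (geo ((s.filter (¬ k ≤ ·)).image (k - ·)))
    rw [Finset.sum_image]
    · refine Finset.sum_congr rfl fun i hi => ?_
      rw [Finset.mem_filter] at hi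
      congr 1; omega
    · intro i hi j hj hij
      simp at hi hj hij
      omega
  calc _ ≤ (1 - θ)⁻¹ + (1 - θ)⁻¹ := add_le_add e1 e2
    _ = _ := by ring

lemma pow_mul_le_of_gap {y : ℕ → ℝ} {q : ℝ} (hq : 1 < q) (hgap : ∀ k, q * y k ≤ y (k + 1))
    (k d : ℕ) : q ^ d * y k ≤ y (k + d) := by
  induction d with
  | zero => simp
  | succ d ih =>
    calc q ^ (d + 1) * y k = q * (q ^ d * y k) := by ring
      _ ≤ q * y (k + d) := by gcongr
      _ ≤ _ := hgap _

/-- Bump functions of a lacunary sequence have uniformly bounded sums. -/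
lemma exists_sum_min_rpow_le {q γ : ℝ} (hq : 1 < q) (hγ : 0 < γ) :
    ∃ W : ℝ, 0 < W ∧ ∀ y : ℕ → ℝ, (∀ k, 0 < y k) → (∀ k, q * y k ≤ y (k + 1)) →
      ∀ s : Finset ℕ, ∑ k ∈ s, min (y k ^ γ) (y k ^ (-γ)) ≤ W := by
  have hq0 : 0 < q := by linarith
  set θ := q ^ (-γ) with hθ
  have hθ0 : 0 < θ := by positivity
  have hθ1 : θ < 1 := Real.rpow_lt_one_of_one_lt_of_neg hq (by linarith)
  refine ⟨θ⁻¹ * (2 / (1 - θ)), by have : 0 < 1 - θ := by linarith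
                                  positivity, fun y hy hgap s => ?_⟩
  have hex : ∃ k, 1 ≤ y k := by
    obtain ⟨n, hn⟩ := pow_unbounded_of_one_lt (1 / y 0) hq
    refine ⟨0 + n, le_trans ?_ (pow_mul_le_of_gap hq hgap 0 n)⟩
    rw [div_lt_iff₀ (hy 0)] at hn
    exact hn.le
  classical
  -- The sequence crosses 1 at k₀, and the terms decay geometrically on both sides. Below k₀ only y
  -- (k₀ - 1) < 1 is known, one step late, hence the factor θ⁻¹.
  set k₀ := Nat.find hex with hk₀
  have hpow : ∀ d : ℕ, θ ^ d = (q ^ d) ^ (-γ) := fun d => by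
    rw [hθ, ← Real.rpow_natCast, ← Real.rpow_natCast, ← Real.rpow_mul hq0.le,
      ← Real.rpow_mul hq0.le, mul_comm]
  have key : ∀ k ∈ s, min (y k ^ γ) (y k ^ (-γ)) ≤ θ⁻¹ * θ ^ ((k - k₀) + (k₀ - k)) := by
    intro k _
    rcases le_or_gt k₀ k with h | h
    · refine (min_le_right _ _).trans ?_
      have h1 : q ^ (k - k₀) ≤ y k := by
        have := pow_mul_le_of_gap hq hgap k₀ (k - k₀)
        rw [Nat.add_sub_cancel' h] at this
        refine le_trans ?_ this
        exact le_mul_of_one_le_right (by positivity) (Nat.find_spec hex)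
      have h2 : y k ^ (-γ) ≤ θ ^ (k - k₀) := by
        rw [hpow]
        exact Real.rpow_le_rpow_of_nonpos (by positivity) h1 (by linarith)
      rw [Nat.sub_eq_zero_of_le h, add_zero]
      refine h2.trans (le_mul_of_one_le_left (by positivity) ?_)
      exact (one_le_inv₀ hθ0).2 hθ1.le
    · refine (min_le_left _ _).trans ?_
      obtain ⟨d, hd⟩ : ∃ d, k₀ = k + d + 1 := ⟨k₀ - k - 1, by omega⟩
      have h1 : q ^ d * y k ≤ 1 := by
        refine (pow_mul_le_of_gap hq hgap k d).trans (le_of_lt ?_)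
        have := Nat.find_min hex (m := k + d) (by omega)
        exact not_le.1 this
      rw [show (k - k₀) + (k₀ - k) = d + 1 by omega, pow_succ', ← mul_assoc,
        inv_mul_cancel₀ hθ0.ne', one_mul, hpow, Real.rpow_neg (by positivity),
        ← Real.inv_rpow (by positivity)]
      refine Real.rpow_le_rpow (hy k).le ?_ hγ.le
      rw [le_inv_comm₀ (hy k) (by positivity), ← one_div, le_div_iff₀ (hy k)]
      exact h1
  calc _ ≤ ∑ k ∈ s, θ⁻¹ * θ ^ ((k - k₀) + (k₀ - k)) := Finset.sum_le_sum key
    _ ≤ _ := by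
      rw [← Finset.mul_sum]
      gcongr
      exact sum_pow_dist_le hθ0.le hθ1 s k₀

/-- Raise t ≤ e^t, at t = b x / η, to the power η. -/
lemma exists_rpow_mul_exp_neg_le {η b : ℝ} (hη : 0 < η) (hb : 0 < b) :
    ∃ C : ℝ, 0 < C ∧ ∀ x : ℝ, 0 ≤ x → x ^ η * Real.exp (-(b * x)) ≤ C := by
  refine ⟨(η / b) ^ η, by positivity, fun x hx => ?_⟩
  have h1 : x * b / η ≤ Real.exp (x * b / η) := by linarith [Real.add_one_le_exp (x * b / η)]
  have h2 : (x * b / η) ^ η ≤ Real.exp (b * x) := by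
    refine (Real.rpow_le_rpow (by positivity) h1 hη.le).trans (le_of_eq ?_)
    rw [← Real.exp_mul]; congr 1; field_simp
  have h3 : x ^ η = (η / b) ^ η * (x * b / η) ^ η := by
    rw [← Real.mul_rpow (by positivity) (by positivity)]; congr 1; field_simp
  rw [h3, mul_assoc]
  apply mul_le_of_le_one_right (by positivity)
  rw [Real.exp_neg, ← div_eq_mul_inv]
  exact (div_le_one (Real.exp_pos _)).2 h2

/-- Since x ≥ 1, the multiplicative gap gives an additive gap of at least 1 - 1 / q on either side.
The value y = 0 is allowed and covers the multiplier w = 1. -/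
lemma le_abs_exp_neg_sub {q R x y : ℝ} (hq : 1 < q) (hx : 1 ≤ x) (hxR : x ≤ R)
    (h : q * y ≤ x ∨ q * x ≤ y) :
    Real.exp (-R) * (1 - Real.exp (-(1 - 1 / q))) ≤ |Real.exp (-x) - Real.exp (-y)| := by
  have hq0 : 0 < q := by linarith
  have hR : Real.exp (-R) ≤ Real.exp (-x) := Real.exp_le_exp.2 (by linarith)
  have hδ : 0 ≤ 1 - 1 / q := by
    rw [sub_nonneg, div_le_one hq0]; exact hq.le
  have hq1 : q * (1 / q) = 1 := by field_simp
  have hpos : 0 ≤ 1 - Real.exp (-(1 - 1 / q)) := by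
    rw [sub_nonneg]; exact Real.exp_le_one_iff.2 (by linarith)
  rcases h with h | h
  · have h1 : y ≤ x - (1 - 1 / q) := by
      have : y ≤ x * (1 / q) := by
        rw [mul_one_div, le_div_iff₀ hq0]; linarith
      have h2 : 0 ≤ (x - 1) * (1 - 1 / q) := mul_nonneg (by linarith) hδ
      nlinarith
    rw [abs_sub_comm]
    refine le_trans ?_ (le_abs_self _)
    have h2 : Real.exp (-x) = Real.exp (-y) * Real.exp (-(x - y)) := by
      rw [← Real.exp_add]; congr 1; ring
    have h3 : Real.exp (-(x - y)) ≤ Real.exp (-(1 - 1 / q)) := Real.exp_le_exp.2 (by linarith)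
    have h4 : Real.exp (-R) ≤ Real.exp (-y) := Real.exp_le_exp.2 (by linarith)
    calc _ ≤ Real.exp (-y) * (1 - Real.exp (-(x - y))) := by gcongr
      _ = _ := by rw [h2]; ring
  · have h1 : 1 - 1 / q ≤ y - x := by
      have : (1 : ℝ) - 1 / q ≤ q - 1 := by
        have : 0 ≤ (q - 1) * (1 - 1 / q) := mul_nonneg (by linarith) hδ
        nlinarith
      nlinarith
    refine le_trans ?_ (le_abs_self _)
    have h2 : Real.exp (-y) = Real.exp (-x) * Real.exp (-(y - x)) := by
      rw [← Real.exp_add]; congr 1; ring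
    have h3 : Real.exp (-(y - x)) ≤ Real.exp (-(1 - 1 / q)) := Real.exp_le_exp.2 (by linarith)
    calc _ ≤ Real.exp (-x) * (1 - Real.exp (-(y - x))) := by gcongr
      _ = _ := by rw [h2]; ring

end Sequences

/-! ### Products of difference operators -/

section ShiftProd
variable {𝕜 : Type*} [RCLike 𝕜]

/-- The composition of the difference operators `f ↦ f(· + 1) - w f`, for `w` in a list. -/
def shiftProd : List ℝ → (ℝ → 𝕜) → ℝ → 𝕜
  | [], f => f
  | w :: ws, f => shiftProd ws fun s => f (s + 1) - (w : 𝕜) * f s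

lemma shiftProd_append (l₁ l₂ : List ℝ) (f : ℝ → 𝕜) :
    shiftProd (l₁ ++ l₂) f = shiftProd l₂ (shiftProd l₁ f) := by
  induction l₁ generalizing f with
  | nil => rfl
  | cons w ws ih => exact ih _

lemma shiftProd_sum {ι : Type*} (I : Finset ι) (l : List ℝ) (f : ι → ℝ → 𝕜) (s : ℝ) :
    shiftProd l (fun s => ∑ i ∈ I, f i s) s = ∑ i ∈ I, shiftProd l (f i) s := by
  induction l generalizing f with
  | nil => rfl
  | cons w ws ih =>
    simp only [shiftProd, ← ih, Finset.mul_sum, Finset.sum_sub_distrib]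

lemma continuous_shiftProd (l : List ℝ) {f : ℝ → 𝕜} (hf : Continuous f) :
    Continuous (shiftProd l f) := by
  induction l generalizing f with
  | nil => exact hf
  | cons w ws ih => exact ih (by fun_prop)

lemma shiftProd_expSum (l : List ℝ) (A : Finset ℝ) (c : ℝ → 𝕜) :
    shiftProd l (expSum A c) =
      expSum A fun μ => c μ * (((l.map fun w => Real.exp (-μ) - w).prod : ℝ) : 𝕜) := by
  induction l generalizing c with
  | nil => simp [shiftProd]
  | cons w ws ih =>
    simp only [shiftProd, expSum_shift_sub, mul_one]
    rw [ih]
    simp [mul_assoc]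

lemma shiftProd_expSum_eq_zero {l : List ℝ} {A : Finset ℝ} (h : ∀ μ ∈ A, Real.exp (-μ) ∈ l)
    (c : ℝ → 𝕜) (s : ℝ) : shiftProd l (expSum A c) s = 0 := by
  rw [shiftProd_expSum]
  refine Finset.sum_eq_zero fun μ hμ => ?_
  have : (l.map fun w => Real.exp (-μ) - w).prod = 0 :=
    List.prod_eq_zero (List.mem_map.2 ⟨_, h μ hμ, sub_self _⟩)
  simp [this]

lemma norm_shift_sub_le {w : ℝ} (hw : 0 ≤ w ∧ w ≤ 1) (x y : 𝕜) :
    ‖x - (w : 𝕜) * y‖ ≤ ‖x‖ + ‖y‖ := by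
  refine (norm_sub_le _ _).trans ?_
  rw [norm_mul, RCLike.norm_ofReal, abs_of_nonneg hw.1]
  have := mul_le_of_le_one_left (norm_nonneg y) hw.2
  linarith

lemma norm_shiftProd_le {l : List ℝ} (hl : ∀ w ∈ l, 0 ≤ w ∧ w ≤ 1) {f : ℝ → 𝕜} {s₀ b : ℝ}
    (hf : ∀ s, s₀ ≤ s → ‖f s‖ ≤ b) (s : ℝ) (hs : s₀ ≤ s) :
    ‖shiftProd l f s‖ ≤ 2 ^ l.length * b := by
  induction l generalizing f b with
  | nil => simpa [shiftProd] using hf s hs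
  | cons w ws ih =>
    have := ih (fun w hw => hl w (List.mem_cons_of_mem _ hw)) (b := 2 * b)
      (f := fun s => f (s + 1) - (w : 𝕜) * f s) (by
        intro s hs
        have h1 := norm_shift_sub_le (hl w (List.mem_cons_self ..)) (f (s + 1)) (f s)
        have := hf (s + 1) (by linarith)
        have := hf s hs
        linarith)
    rw [List.length_cons, pow_succ, mul_assoc]
    exact this

/-- Each factor costs 2, as its multiplier lies in [0, 1], and lengthens the window of integration
by one unit to the right. -/
lemma integral_norm_shiftProd_le {l : List ℝ} (hl : ∀ w ∈ l, 0 ≤ w ∧ w ≤ 1) {f : ℝ → 𝕜}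
    (hf : Continuous f) {a x : ℝ} (hx : a ≤ x) :
    ∫ u in a..x, ‖shiftProd l f u‖ ≤ 2 ^ l.length * ∫ u in a..(x + l.length), ‖f u‖ := by
  induction l generalizing f with
  | nil => simp [shiftProd]
  | cons w ws ih =>
    have h1 := ih (fun w hw => hl w (List.mem_cons_of_mem _ hw))
      (f := fun s => f (s + 1) - (w : 𝕜) * f s) (by fun_prop)
    have hlen : (0 : ℝ) ≤ ws.length := by positivity
    have hmono : ∀ c d, a ≤ c → c ≤ d → d ≤ x + ws.length + 1 →
        ∫ u in c..d, ‖f u‖ ≤ ∫ u in a..(x + ws.length + 1), ‖f u‖ := fun c d h1 h2 h3 =>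
      intervalIntegral.integral_mono_interval h1 h2 h3
        (Eventually.of_forall fun u => norm_nonneg _) (hf.norm.intervalIntegrable _ _)
    have h2 : ∫ u in a..(x + ws.length), ‖f (u + 1) - (w : 𝕜) * f u‖ ≤
        ∫ u in a..(x + ws.length), (‖f (u + 1)‖ + ‖f u‖) := by
      apply intervalIntegral.integral_mono_on (by linarith)
      · exact (by fun_prop : Continuous fun u => ‖f (u + 1) - (w : 𝕜) * f u‖).intervalIntegrable _ _
      · exact (by fun_prop : Continuous fun u => ‖f (u + 1)‖ + ‖f u‖).intervalIntegrable _ _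
      · intro u _
        exact norm_shift_sub_le (hl w (List.mem_cons_self ..)) _ _
    rw [intervalIntegral.integral_add (f := fun u => ‖f (u + 1)‖)
        ((by fun_prop : Continuous fun u => ‖f (u + 1)‖).intervalIntegrable _ _)
        (hf.norm.intervalIntegrable _ _),
      intervalIntegral.integral_comp_add_right (fun u => ‖f u‖)] at h2
    have h3 := hmono (a + 1) (x + ws.length + 1) (by linarith) (by linarith) le_rfl
    have h4 := hmono a (x + ws.length) le_rfl (by linarith) (by linarith)
    rw [List.length_cons, pow_succ, mul_assoc]
    push_cast
    rw [← add_assoc]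
    refine h1.trans ?_
    gcongr
    linarith

/-- A difference operator preserves the set of exponents, so the factors can be inverted one at a
time. The one-factor estimate is a hypothesis so that its constant is fixed before the list of
multipliers. -/
lemma norm_expSum_le_of_shiftProd {N : ℕ} {d C : ℝ}
    (h : ∀ A : Finset ℝ, A.card ≤ N → ∀ w : ℝ,
      (∀ μ ∈ A, 0 ≤ μ ∧ d ≤ |Real.exp (-μ) - w|) → ∀ (c : ℝ → 𝕜) (ε : ℝ),
      (∀ s, 0 ≤ s → ‖expSum A c (s + 1) - (w : 𝕜) * expSum A c s‖ ≤ ε) →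
      ∀ s, 0 ≤ s → ‖expSum A c s‖ ≤ C * ε)
    {A : Finset ℝ} (hA : A.card ≤ N) (l : List ℝ)
    (hl : ∀ w ∈ l, ∀ μ ∈ A, 0 ≤ μ ∧ d ≤ |Real.exp (-μ) - w|) (c : ℝ → 𝕜) (ε : ℝ)
    (hε : ∀ s, 0 ≤ s → ‖shiftProd l (expSum A c) s‖ ≤ ε) (s : ℝ) (hs : 0 ≤ s) :
    ‖expSum A c s‖ ≤ C ^ l.length * ε := by
  induction l generalizing c s with
  | nil => simpa [shiftProd] using hε s hs
  | cons w ws ih =>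
    simp only [shiftProd, expSum_shift_sub, mul_one] at hε
    have h1 := ih (fun w hw => hl w (List.mem_cons_of_mem _ hw)) _ hε
    have h2 := h A hA w (hl w (List.mem_cons_self ..)) c (C ^ ws.length * ε) (by
      simpa only [expSum_shift_sub, mul_one] using h1) s hs
    rw [List.length_cons, pow_succ', mul_assoc]
    exact h2

/-- Dilating by ρ brings the exponents into [0, R] and makes the unit shift a shift by ρ, so the
Lipschitz bound gains a factor C ρ each time. This damps the low frequencies. -/
lemma norm_shiftProd_replicate_one_le {N : ℕ} {R C : ℝ}
    (h : ∀ A : Finset ℝ, A.card ≤ N → (∀ μ ∈ A, 0 ≤ μ ∧ μ ≤ R) →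
      ∀ (c : ℝ → 𝕜) (G : ℝ), (∀ s, 0 ≤ s → ‖expSum A c s‖ ≤ G) →
      ∀ s δ, 0 ≤ s → 0 ≤ δ → ‖expSum A c (s + δ) - expSum A c s‖ ≤ C * δ * G)
    {A : Finset ℝ} (hA : A.card ≤ N) {ρ : ℝ} (hρ : 0 < ρ) (hAR : ∀ μ ∈ A, 0 ≤ μ ∧ μ ≤ ρ * R)
    (P : ℕ) (c : ℝ → 𝕜) (G : ℝ) (hG : ∀ s, 0 ≤ s → ‖expSum A c s‖ ≤ G) (s : ℝ) (hs : 0 ≤ s) :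
    ‖shiftProd (List.replicate P 1) (expSum A c) s‖ ≤ (C * ρ) ^ P * G := by
  induction P generalizing c G s with
  | zero => simpa [shiftProd] using hG s hs
  | succ P ih =>
    rw [List.replicate_succ]
    simp only [shiftProd, expSum_shift_sub, mul_one]
    rw [pow_succ, mul_assoc]
    refine ih _ _ (fun s hs => ?_) s hs
    have e := expSum_shift_sub A c 1 1 s
    simp only [mul_one] at e
    rw [← e, RCLike.ofReal_one, one_mul]
    have hcard : (A.image (· / ρ)).card ≤ N := Finset.card_image_le.trans hA
    have := h (A.image (· / ρ)) hcard (by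
      intro μ hμ
      obtain ⟨ν, hν, rfl⟩ := Finset.mem_image.1 hμ
      obtain ⟨h1, h2⟩ := hAR ν hν
      exact ⟨div_nonneg h1 hρ.le, by rw [div_le_iff₀ hρ]; linarith⟩) (fun ν => c (ν * ρ)) G (by
      intro s hs
      rw [← expSum_div hρ.ne']
      exact hG _ (by positivity)) (s * ρ) ρ (by positivity) hρ.le
    rw [← expSum_div hρ.ne', ← expSum_div hρ.ne', add_div, mul_div_cancel_right₀ _ hρ.ne',
      div_self hρ.ne'] at this
    exact this

end ShiftProd

/-! ### Isolating one block of a sum -/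

section Blocks
variable {𝕜 : Type*} [RCLike 𝕜]

/-- Finite blocks `E k` of at most `N` exponents, comparable with the lacunary scale `m k`. -/
structure IsBlockSystem (m : ℕ → ℝ) (E : ℕ → Finset ℝ) (N : ℕ) (q r R : ℝ) : Prop where
  one_lt : 1 < q
  scale_pos : ∀ k, 0 < m k
  scale_gap : ∀ k, q * m k ≤ m (k + 1)
  card_le : ∀ k, (E k).card ≤ N
  mem_bounds : ∀ k, ∀ μ ∈ E k, r * m k ≤ μ ∧ μ ≤ R * m k

/-- The size `m ^ (-γ) ∫_1^2 |g (u / m)| du` of a function `g` at the scale `1 / m`. -/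
noncomputable def scaleMean (γ m : ℝ) (g : ℝ → 𝕜) : ℝ :=
  m ^ (-γ) * ∫ u in (1 : ℝ)..2, ‖g (u / m)‖

lemma scaleMean_nonneg (γ : ℝ) {m : ℝ} (hm : 0 ≤ m) (g : ℝ → 𝕜) : 0 ≤ scaleMean γ m g :=
  mul_nonneg (by positivity)
    (intervalIntegral.integral_nonneg (by norm_num) fun _ _ => norm_nonneg _)

namespace IsBlockSystem
variable {m : ℕ → ℝ} {E : ℕ → Finset ℝ} {N : ℕ} {q r R : ℝ}

/-- Dilation by m k brings the exponents of the block into [r, R]; the one-block estimate enters as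
a hypothesis to keep its constant uniform in k. -/
lemma norm_le (h : IsBlockSystem m E N q r R) {C : ℝ}
    (hC : ∀ A : Finset ℝ, A.card ≤ N → (∀ μ ∈ A, r ≤ μ ∧ μ ≤ R) → ∀ c : ℝ → 𝕜,
      ∀ s, 0 ≤ s → ‖expSum A c s‖ ≤
        C * Real.exp (-(r / 2 * s)) * ∫ u in (1 : ℝ)..2, ‖expSum A c u‖)
    (k : ℕ) (c : ℝ → 𝕜) (s : ℝ) (hs : 0 ≤ s) :
    ‖expSum (E k) c s‖ ≤ C * Real.exp (-(r / 2 * (m k * s))) *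
      ∫ u in (1 : ℝ)..2, ‖expSum (E k) c (u / m k)‖ := by
  have hm := h.scale_pos k
  have := hC ((E k).image (· / m k)) (Finset.card_image_le.trans (h.card_le k)) (by
    intro μ hμ
    obtain ⟨ν, hν, rfl⟩ := Finset.mem_image.1 hμ
    obtain ⟨h1, h2⟩ := h.mem_bounds k ν hν
    exact ⟨by rwa [le_div_iff₀ hm], by rwa [div_le_iff₀ hm]⟩) (fun ν => c (ν * m k)) (m k * s)
      (by positivity)
  simp only [← expSum_div hm.ne'] at this
  rwa [mul_div_cancel_left₀ _ hm.ne'] at this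

/-- The size of a block of a sum is controlled by the sum at the corresponding scale, up to a
small multiple of the sizes of the other blocks. -/
lemma scaleMean_le (h : IsBlockSystem m E N q 1 R)
    (hsep : ∀ i k, i < k → ∀ μ ∈ E i, ∀ ν ∈ E k, q * μ ≤ ν) {γ : ℝ} (hγ : 0 < γ) :
    ∃ C : ℝ, 0 < C ∧ ∀ M : ℕ, ∃ B Y : ℝ, 0 ≤ B ∧ 1 ≤ Y ∧
      ∀ (c : ℕ → ℝ → 𝕜) (s : Finset ℕ), ∀ k ∈ s,
        scaleMean γ (m k) (expSum (E k) (c k)) ≤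
          B * (m k ^ (-γ) * ∫ u in (1 : ℝ)..Y, ‖∑ i ∈ s, expSum (E i) (c i) (u / m k)‖) +
          C * (1 / 2) ^ M * ∑ i ∈ s, (1 / 2) ^ ((i - k) + (k - i)) *
            scaleMean γ (m i) (expSum (E i) (c i)) := by
  have hq := h.one_lt
  have hq0 : 0 < q := by linarith
  obtain ⟨CA, hCA1, hCA⟩ := norm_expSum_le_integral 𝕜 N (R := R) one_pos
  obtain ⟨CB, hCB0, hCB⟩ := norm_expSum_sub_le 𝕜 N R
  set d := Real.exp (-R) * (1 - Real.exp (-(1 - 1 / q))) with hd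
  have hd0 : 0 < d := by
    refine mul_pos (Real.exp_pos _) ?_
    have h1 : 0 < 1 - 1 / q := by rw [sub_pos, div_lt_one hq0]; exact hq
    have := Real.exp_lt_exp.2 (neg_lt_zero.2 h1)
    rw [Real.exp_zero] at this
    linarith
  obtain ⟨K, hK1, hK⟩ := norm_expSum_le_of_shift_sub 𝕜 N hd0
  have hCA0 : 0 < CA := by linarith
  have hK0 : 0 < K := by linarith
  -- D is the price of increasing M by one: two more blocks, so at most 2N more multipliers, each
  -- costing 2 to apply and K to invert.
  set D := (2 * K) ^ (2 * N) with hD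
  have hD1 : 1 ≤ D := one_le_pow₀ (by linarith)
  -- At distance e the gain is q^{P e} > (4 D)^e. For e > M this pays for D^M and leaves 4^{-e} ≤
  -- 2^{-M} 2^{-e}. Neither P nor the final C depends on M.
  obtain ⟨P, hP⟩ := pow_unbounded_of_one_lt (4 * D) hq
  obtain ⟨C₁, hC₁0, hC₁⟩ := exists_rpow_mul_exp_neg_le (η := P + γ) (b := 1 / 2)
    (by positivity) (by norm_num)
  refine ⟨(2 * K) ^ P * CA ^ 2 * (C₁ + CB ^ P), by positivity, fun M => ?_⟩
  -- The window is lengthened by one unit for each of the at most P + 2MN multipliers.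
  refine ⟨(2 * K) ^ P * D ^ M * CA, 2 + (P + 2 * M * N), by positivity, ?_, fun c s k hk => ?_⟩
  · have : (0 : ℝ) ≤ P + 2 * M * N := by positivity
    linarith
  have hmk := h.scale_pos k
  -- the rescaled blocks
  set E' : ℕ → Finset ℝ := fun i => (E i).image (· / m k) with hE'
  set c' : ℕ → ℝ → 𝕜 := fun i ν => c i (ν * m k) with hc'
  have hg : ∀ i u, expSum (E i) (c i) (u / m k) = expSum (E' i) (c' i) u :=
    fun i u => expSum_div hmk.ne' _ _ _
  set a : ℕ → ℝ := fun i => ∫ u in (1 : ℝ)..2, ‖expSum (E i) (c i) (u / m i)‖ with ha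
  have ha0 : ∀ i, 0 ≤ a i := fun i =>
    intervalIntegral.integral_nonneg (by norm_num) fun _ _ => norm_nonneg _
  have hcard : ∀ i, (E' i).card ≤ N := fun i => Finset.card_image_le.trans (h.card_le i)
  have hmem : ∀ i, ∀ μ ∈ E' i, m i / m k ≤ μ ∧ μ ≤ m i / m k * R := by
    intro i μ hμ
    obtain ⟨ν, hν, rfl⟩ := Finset.mem_image.1 hμ
    obtain ⟨h1, h2⟩ := h.mem_bounds i ν hν
    constructor
    · gcongr; linarith
    · rw [div_mul_eq_mul_div]; gcongr; linarith
  have hpos : ∀ i, ∀ μ ∈ E' i, 0 ≤ μ := fun i μ hμ =>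
    (div_pos (h.scale_pos i) hmk).le.trans (hmem i μ hμ).1
  have hbd : ∀ i u, 0 ≤ u →
      ‖expSum (E' i) (c' i) u‖ ≤ CA * Real.exp (-(1 / 2 * (m i / m k * u))) * a i := by
    intro i u hu
    have := h.norm_le hCA i (c i) (u / m k) (by positivity)
    rw [hg, show m i * (u / m k) = m i / m k * u by ring] at this
    exact this
  have hbd' : ∀ i u, 0 ≤ u → ‖expSum (E' i) (c' i) u‖ ≤ CA * a i := by
    intro i u hu
    refine (hbd i u hu).trans ?_
    have h1 : Real.exp (-(1 / 2 * (m i / m k * u))) ≤ 1 := Real.exp_le_one_iff.2 (by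
      have := h.scale_pos i
      have : 0 ≤ m i / m k * u := by positivity
      linarith)
    have := ha0 i
    calc _ ≤ CA * 1 * a i := by gcongr
      _ = _ := by ring
  -- the multipliers
  set W : Finset ℝ := ((Finset.Icc (k - M) (k + M)).erase k).biUnion E' with hW
  set l₂ : List ℝ := W.toList.map fun μ => Real.exp (-μ) with hl₂
  set l : List ℝ := List.replicate P 1 ++ l₂ with hl
  have hmemW : ∀ {μ}, μ ∈ W ↔ ∃ j, (j ≠ k ∧ k ≤ j + M ∧ j ≤ k + M) ∧ μ ∈ E' j := by
    intro μ
    simp only [hW, Finset.mem_biUnion, Finset.mem_erase, Finset.mem_Icc, Nat.sub_le_iff_le_add]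
  have hWcard : W.card ≤ 2 * M * N := by
    refine Finset.card_biUnion_le_card_mul _ _ N (fun i _ => hcard i) |>.trans ?_
    gcongr
    rw [Finset.card_erase_of_mem (by simp), Nat.card_Icc]
    omega
  have hlen₂ : l₂.length ≤ 2 * M * N := by simpa [hl₂] using hWcard
  have hlen : l.length ≤ P + 2 * M * N := by simpa [hl] using hlen₂
  have hl₂01 : ∀ w ∈ l₂, 0 ≤ w ∧ w ≤ 1 := by
    intro w hw
    obtain ⟨μ, hμ, rfl⟩ := List.mem_map.1 hw
    obtain ⟨j, -, hj⟩ := hmemW.1 (Finset.mem_toList.1 hμ)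
    exact ⟨(Real.exp_pos _).le, Real.exp_le_one_iff.2 (by linarith [hpos j μ hj])⟩
  have hl01 : ∀ w ∈ l, 0 ≤ w ∧ w ≤ 1 := by
    intro w hw
    rcases List.mem_append.1 hw with hw | hw
    · rw [List.eq_of_mem_replicate hw]; norm_num
    · exact hl₂01 w hw
  have hself : ∀ μ ∈ E' k, 1 ≤ μ ∧ μ ≤ R := by
    intro μ hμ
    have := hmem k μ hμ
    rwa [div_self hmk.ne', one_mul] at this
  have hsep' : ∀ i j, i < j → ∀ μ ∈ E' i, ∀ ν ∈ E' j, q * μ ≤ ν := by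
    intro i j hij μ hμ ν hν
    obtain ⟨x, hx, rfl⟩ := Finset.mem_image.1 hμ
    obtain ⟨y, hy, rfl⟩ := Finset.mem_image.1 hν
    have := hsep i j hij x hx y hy
    rw [← mul_div_assoc]
    gcongr
  have hlsep : ∀ w ∈ l, ∀ μ ∈ E' k, 0 ≤ μ ∧ d ≤ |Real.exp (-μ) - w| := by
    intro w hw μ hμ
    obtain ⟨h1, h2⟩ := hself μ hμ
    refine ⟨by linarith, ?_⟩
    rcases List.mem_append.1 hw with hw | hw
    · rw [List.eq_of_mem_replicate hw]
      have := le_abs_exp_neg_sub hq h1 h2 (y := 0) (Or.inl (by linarith))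
      rwa [neg_zero, Real.exp_zero] at this
    · obtain ⟨ν, hν, rfl⟩ := List.mem_map.1 hw
      obtain ⟨j, ⟨hjk, -, -⟩, hj⟩ := hmemW.1 (Finset.mem_toList.1 hν)
      apply le_abs_exp_neg_sub hq h1 h2
      rcases lt_or_gt_of_ne hjk with hjk | hjk
      · exact Or.inl (hsep' j k hjk ν hj μ hμ)
      · exact Or.inr (hsep' k j hjk μ hμ ν hj)
  have hpow : ∀ {x : ℝ}, 1 ≤ x → x ^ l.length ≤ x ^ (P + 2 * M * N) := fun hx =>
    pow_le_pow_right₀ hx hlen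
  have hDM : (2 * K) ^ (P + 2 * M * N) = (2 * K) ^ P * D ^ M := by
    rw [pow_add, hD, ← pow_mul]; congr 2; ring
  have hKpow : K ^ l.length * 2 ^ l.length ≤ (2 * K) ^ P * D ^ M := by
    rw [← mul_pow, mul_comm K, ← hDM]
    exact hpow (by linarith)
  -- lower bound for the main block
  set T : ℕ → ℝ → 𝕜 := fun i => shiftProd l (expSum (E' i) (c' i)) with hT
  have hTc : ∀ i, Continuous (T i) := fun i => continuous_shiftProd _ (continuous_expSum _ _)
  -- T k is again an exponential sum over `E' k`, so its mean over [1, 2] bounds it on the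
  -- half-line; inverting the multipliers then returns to the original block.
  have hmain : a k ≤ K ^ l.length * CA * ∫ u in (1 : ℝ)..2, ‖T k u‖ := by
    have hTk : ∀ u, 0 ≤ u → ‖T k u‖ ≤ CA * ∫ u in (1 : ℝ)..2, ‖T k u‖ := by
      intro u hu
      simp only [hT, shiftProd_expSum]
      refine (hCA _ (hcard k) hself _ u hu).trans ?_
      have h1 : Real.exp (-(1 / 2 * u)) ≤ 1 := Real.exp_le_one_iff.2 (by linarith)
      refine mul_le_mul_of_nonneg_right ?_
        (intervalIntegral.integral_nonneg (by norm_num) fun _ _ => norm_nonneg _)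
      exact mul_le_of_le_one_right hCA0.le h1
    have h1 := norm_expSum_le_of_shiftProd hK (hcard k) l hlsep (c' k) _ hTk
    have h2 : a k ≤ ∫ u in (1 : ℝ)..2, K ^ l.length * (CA * ∫ u in (1 : ℝ)..2, ‖T k u‖) := by
      simp only [ha, hg]
      apply intervalIntegral.integral_mono_on (by norm_num)
      · exact (continuous_expSum _ _).norm.intervalIntegrable _ _
      · simp
      · intro u hu
        exact h1 u (by linarith [hu.1])
    rw [intervalIntegral.integral_const, smul_eq_mul] at h2
    calc a k ≤ _ := h2
      _ = _ := by ring
  -- the other blocks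
  have hfar : ∀ i, i ≠ k → ∃ b, 0 ≤ b ∧ (∀ u, 1 ≤ u → ‖T i u‖ ≤ b) ∧
      K ^ l.length * CA * b * m k ^ (-γ) ≤ (2 * K) ^ P * CA ^ 2 * (C₁ + CB ^ P) * (1 / 2) ^ M *
        (1 / 2) ^ ((i - k) + (k - i)) * (m i ^ (-γ) * a i) := by
    intro i hik
    have hmi := h.scale_pos i
    have hai := ha0 i
    have hρ : 0 < m i / m k := by positivity
    have hmi' : m k ^ (-γ) = (m i / m k) ^ γ * m i ^ (-γ) := by
      rw [Real.div_rpow hmi.le hmk.le, Real.rpow_neg hmk.le, Real.rpow_neg hmi.le]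
      field_simp
    set ρ := m i / m k with hρdef
    have hquarter : ∀ e, M < e → (1 / 4 : ℝ) ^ e ≤ (1 / 2) ^ M * (1 / 2) ^ e := by
      intro e he
      rw [show (1 / 4 : ℝ) = 1 / 2 * (1 / 2) by norm_num, mul_pow]
      gcongr ?_ * _
      exact pow_le_pow_of_le_one (by norm_num) (by norm_num) he.le
    have hDe : ∀ e, M < e → D ^ M * 4 ^ e ≤ (q ^ P) ^ e := by
      intro e he
      calc D ^ M * 4 ^ e ≤ D ^ e * 4 ^ e := by gcongr
        _ = (4 * D) ^ e := by rw [mul_pow]; ring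
        _ ≤ _ := by gcongr
    -- Blocks within distance M are annihilated: their multipliers occur in l₂.
    by_cases hnear : k ≤ i + M ∧ i ≤ k + M
    · refine ⟨0, le_rfl, fun u _ => ?_, by
        rw [mul_zero, zero_mul]; positivity⟩
      have : T i u = 0 := by
        apply shiftProd_expSum_eq_zero
        intro μ hμ
        refine List.mem_append_right _ (List.mem_map.2 ⟨μ, Finset.mem_toList.2 ?_, rfl⟩)
        exact hmemW.2 ⟨i, ⟨hik, hnear⟩, hμ⟩
      simp [this]
    rcases lt_or_gt_of_ne hik with hlt | hgt
    · -- low frequencies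
      obtain ⟨e, he⟩ : ∃ e, k = i + e := ⟨k - i, by omega⟩
      have heM : M < e := by omega
      have hρe : ρ * q ^ e ≤ 1 := by
        have := pow_mul_le_of_gap hq h.scale_gap i e
        rw [hρdef, div_mul_eq_mul_div, div_le_one hmk, he]
        linarith
      have hρ1 : ρ ≤ 1 := by
        have : 1 ≤ q ^ e := one_le_pow₀ hq.le
        nlinarith
      -- The P factors with multiplier 1 give (C ρ)^P, where ρ ≤ q^{-e}; the remaining factors only
      -- cost powers of 2.
      refine ⟨2 ^ l.length * ((CB * ρ) ^ P * (CA * a i)), by positivity, fun u hu => ?_, ?_⟩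
      · have h1 := norm_shiftProd_replicate_one_le hCB (hcard i) hρ
          (fun μ hμ => ⟨hpos i μ hμ, (hmem i μ hμ).2⟩) P (c' i) _ (hbd' i)
        simp only [hT, hl, shiftProd_append]
        refine (norm_shiftProd_le hl₂01 h1 u (by linarith)).trans ?_
        gcongr
        · norm_num
        · simp
      · rw [show (i - k) + (k - i) = e by omega]
        have h1 : ρ ^ γ ≤ 1 := Real.rpow_le_one hρ.le hρ1 hγ.le
        have h2 : D ^ M * ρ ^ P ≤ (1 / 2) ^ M * (1 / 2) ^ e := by
          refine le_trans ?_ (hquarter e heM)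
          have h3 : D ^ M * 4 ^ e * ρ ^ P ≤ 1 := by
            calc _ ≤ (q ^ P) ^ e * ρ ^ P := by gcongr; exact hDe e heM
              _ = (ρ * q ^ e) ^ P := by ring
              _ ≤ 1 := pow_le_one₀ (by positivity) hρe
          rw [one_div, inv_pow, ← one_div, le_div_iff₀ (by positivity)]
          linarith
        rw [hmi']
        calc K ^ l.length * CA * (2 ^ l.length * ((CB * ρ) ^ P * (CA * a i))) *
              (ρ ^ γ * m i ^ (-γ))
            = (K ^ l.length * 2 ^ l.length) * CA ^ 2 * CB ^ P * ρ ^ P * ρ ^ γ *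
                (m i ^ (-γ) * a i) := by rw [mul_pow]; ring
          _ ≤ ((2 * K) ^ P * D ^ M) * CA ^ 2 * CB ^ P * ρ ^ P * 1 * (m i ^ (-γ) * a i) := by
              gcongr
          _ = ((2 * K) ^ P * CA ^ 2 * CB ^ P) * (D ^ M * ρ ^ P) * (m i ^ (-γ) * a i) := by ring
          _ ≤ ((2 * K) ^ P * CA ^ 2 * (C₁ + CB ^ P)) * ((1 / 2) ^ M * (1 / 2) ^ e) *
                (m i ^ (-γ) * a i) := by
              gcongr
              linarith
          _ = _ := by ring
    · -- high frequencies
      obtain ⟨e, he⟩ : ∃ e, i = k + e := ⟨i - k, by omega⟩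
      have heM : M < e := by omega
      have hρe : q ^ e ≤ ρ := by
        have := pow_mul_le_of_gap hq h.scale_gap k e
        rwa [hρdef, le_div_iff₀ hmk, he]
      -- On u ≥ 1 the block is already of order e^{-ρ/2}, where ρ ≥ q^e; this absorbs both ρ^P,
      -- which dominates the cost, and ρ^γ from the normalisation.
      refine ⟨2 ^ l.length * (CA * Real.exp (-(1 / 2 * ρ)) * a i), by positivity,
        fun u hu => ?_, ?_⟩
      · refine norm_shiftProd_le hl01 (s₀ := 1) (fun v hv => ?_) u hu
        refine (hbd i v (by linarith)).trans ?_
        gcongr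
        nlinarith
      · rw [show (i - k) + (k - i) = e by omega]
        have h2 : D ^ M * (ρ ^ γ * Real.exp (-(1 / 2 * ρ))) ≤ C₁ * ((1 / 2) ^ M * (1 / 2) ^ e) := by
          refine le_trans ?_ (mul_le_mul_of_nonneg_left (hquarter e heM) hC₁0.le)
          have h3 : D ^ M * 4 ^ e * (ρ ^ γ * Real.exp (-(1 / 2 * ρ))) ≤ C₁ := by
            calc _ ≤ ρ ^ P * (ρ ^ γ * Real.exp (-(1 / 2 * ρ))) := by
                  gcongr
                  refine (hDe e heM).trans ?_
                  rw [← pow_mul, mul_comm, pow_mul]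
                  gcongr
              _ = ρ ^ (P + γ) * Real.exp (-(1 / 2 * ρ)) := by
                  rw [Real.rpow_add hρ, Real.rpow_natCast]; ring
              _ ≤ C₁ := hC₁ ρ hρ.le
          rw [one_div 4, inv_pow, ← div_eq_mul_inv, le_div_iff₀ (by positivity)]
          linarith
        rw [hmi']
        calc K ^ l.length * CA * (2 ^ l.length * (CA * Real.exp (-(1 / 2 * ρ)) * a i)) *
              (ρ ^ γ * m i ^ (-γ))
            = (K ^ l.length * 2 ^ l.length) * CA ^ 2 * (ρ ^ γ * Real.exp (-(1 / 2 * ρ))) *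
                (m i ^ (-γ) * a i) := by ring
          _ ≤ ((2 * K) ^ P * D ^ M) * CA ^ 2 * (ρ ^ γ * Real.exp (-(1 / 2 * ρ))) *
                (m i ^ (-γ) * a i) := by
              gcongr
          _ = ((2 * K) ^ P * CA ^ 2) * (D ^ M * (ρ ^ γ * Real.exp (-(1 / 2 * ρ)))) *
                (m i ^ (-γ) * a i) := by ring
          _ ≤ ((2 * K) ^ P * CA ^ 2) * ((C₁ + CB ^ P) * ((1 / 2) ^ M * (1 / 2) ^ e)) *
                (m i ^ (-γ) * a i) := by
              refine mul_le_mul_of_nonneg_right (mul_le_mul_of_nonneg_left (h2.trans ?_)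
                (by positivity)) (by positivity)
              gcongr
              linarith [pow_nonneg hCB0 P]
          _ = _ := by ring
  -- assembling
  choose! b hb0 hb hbsum using hfar
  set F : ℝ → 𝕜 := fun u => ∑ i ∈ s, expSum (E' i) (c' i) u with hF
  have hFc : Continuous F := continuous_finsetSum _ fun i _ => continuous_expSum _ _
  have hTF : ∀ u, shiftProd l F u = T k u + ∑ i ∈ s.erase k, T i u := by
    intro u
    rw [hF, shiftProd_sum, Finset.add_sum_erase s (fun i => T i u) hk]
  have hTk : ∫ u in (1 : ℝ)..2, ‖T k u‖ ≤
      (∫ u in (1 : ℝ)..2, ‖shiftProd l F u‖) + ∑ i ∈ s.erase k, b i := by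
    have h1 : ∫ u in (1 : ℝ)..2, ‖T k u‖ ≤
        ∫ u in (1 : ℝ)..2, (‖shiftProd l F u‖ + ∑ i ∈ s.erase k, b i) := by
      apply intervalIntegral.integral_mono_on (by norm_num) ((hTc k).norm.intervalIntegrable _ _)
      · exact ((continuous_shiftProd l hFc).norm.add continuous_const).intervalIntegrable _ _
      · intro u hu
        have h2 : T k u = shiftProd l F u - ∑ i ∈ s.erase k, T i u := by rw [hTF]; ring
        rw [h2]
        refine (norm_sub_le _ _).trans ?_
        gcongr
        refine (norm_sum_le _ _).trans (Finset.sum_le_sum fun i hi => ?_)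
        exact hb i (Finset.ne_of_mem_erase hi) u hu.1
    rw [intervalIntegral.integral_add ((continuous_shiftProd l hFc).norm.intervalIntegrable _ _)
      (by simp), intervalIntegral.integral_const] at h1
    rw [smul_eq_mul] at h1
    linarith
  have hint : ∫ u in (1 : ℝ)..2, ‖shiftProd l F u‖ ≤
      2 ^ l.length * ∫ u in (1 : ℝ)..(2 + (P + 2 * M * N)), ‖F u‖ := by
    refine (integral_norm_shiftProd_le hl01 hFc (by norm_num)).trans ?_
    gcongr
    have hlenR : (l.length : ℝ) ≤ P + 2 * M * N := by exact_mod_cast hlen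
    have h0 : (0 : ℝ) ≤ l.length := by positivity
    exact intervalIntegral.integral_mono_interval le_rfl (by linarith) (by linarith)
        (Eventually.of_forall fun u => norm_nonneg _) (hFc.norm.intervalIntegrable _ _)
  set J := ∫ u in (1 : ℝ)..(2 + (P + 2 * M * N)), ‖F u‖ with hJ
  have hJ0 : 0 ≤ J := intervalIntegral.integral_nonneg (by
    have : (0 : ℝ) ≤ P + 2 * M * N := by positivity
    linarith) fun _ _ => norm_nonneg _
  have hγk : 0 < m k ^ (-γ) := by positivity
  simp only [scaleMean, hg]
  change m k ^ (-γ) * ∫ u in (1 : ℝ)..2, ‖expSum (E' k) (c' k) u‖ ≤ _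
  have hak : a k = ∫ u in (1 : ℝ)..2, ‖expSum (E' k) (c' k) u‖ := by simp only [ha, hg]
  rw [← hak]
  calc m k ^ (-γ) * a k
      ≤ m k ^ (-γ) * (K ^ l.length * CA * (2 ^ l.length * J + ∑ i ∈ s.erase k, b i)) := by
        gcongr
        refine hmain.trans ?_
        gcongr
        linarith
    _ = (K ^ l.length * 2 ^ l.length) * CA * (m k ^ (-γ) * J) +
          ∑ i ∈ s.erase k, K ^ l.length * CA * b i * m k ^ (-γ) := by
        rw [← Finset.sum_mul, ← Finset.mul_sum]; ring
    _ ≤ ((2 * K) ^ P * D ^ M) * CA * (m k ^ (-γ) * J) +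
          ∑ i ∈ s.erase k, (2 * K) ^ P * CA ^ 2 * (C₁ + CB ^ P) * (1 / 2) ^ M *
            (1 / 2) ^ ((i - k) + (k - i)) * (m i ^ (-γ) * a i) := by
        refine add_le_add (by gcongr) (Finset.sum_le_sum fun i hi => ?_)
        exact hbsum i (Finset.ne_of_mem_erase hi)
    _ ≤ ((2 * K) ^ P * D ^ M) * CA * (m k ^ (-γ) * J) +
          ∑ i ∈ s, (2 * K) ^ P * CA ^ 2 * (C₁ + CB ^ P) * (1 / 2) ^ M *
            (1 / 2) ^ ((i - k) + (k - i)) * (m i ^ (-γ) * a i) := by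
        refine add_le_add le_rfl
          (Finset.sum_le_sum_of_subset_of_nonneg (Finset.erase_subset _ _) fun i _ _ => ?_)
        have := ha0 i
        have := h.scale_pos i
        positivity
    _ = _ := by
        rw [Finset.mul_sum]
        congr 1
        refine Finset.sum_congr rfl fun i _ => ?_
        simp only [ha]
        ring

end IsBlockSystem
end Blocks

/-! ### Jensen inequalities and absorption -/

section PowerMeans

lemma sum_mul_rpow_le {ι : Type*} (s : Finset ι) {p : ℝ} (hp : 1 ≤ p) {w f : ι → ℝ}
    (hw : ∀ i, 0 ≤ w i) (hf : ∀ i, 0 ≤ f i) :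
    (∑ i ∈ s, w i * f i) ^ p ≤ (∑ i ∈ s, w i) ^ (p - 1) * ∑ i ∈ s, w i * f i ^ p := by
  have hp0 : 0 < p := by linarith
  have h0 : 0 ≤ ∑ i ∈ s, w i := Finset.sum_nonneg fun i _ => hw i
  have h1 : 0 ≤ ∑ i ∈ s, w i * f i ^ p :=
    Finset.sum_nonneg fun i _ => mul_nonneg (hw i) (Real.rpow_nonneg (hf i) _)
  have h2 : 0 ≤ ∑ i ∈ s, w i * f i := Finset.sum_nonneg fun i _ => mul_nonneg (hw i) (hf i)
  refine (Real.rpow_le_rpow h2 (Real.inner_le_weight_mul_Lp_of_nonneg s hp w f hw hf)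
    hp0.le).trans (le_of_eq ?_)
  rw [Real.mul_rpow (by positivity) (by positivity), ← Real.rpow_mul h0, ← Real.rpow_mul h1,
    inv_mul_cancel₀ hp0.ne', Real.rpow_one]
  congr 2; field_simp

lemma add_rpow_le_two_rpow_mul {x y p : ℝ} (hx : 0 ≤ x) (hy : 0 ≤ y) (hp : 0 ≤ p) :
    (x + y) ^ p ≤ 2 ^ p * (x ^ p + y ^ p) := by
  have hx' := Real.rpow_nonneg hx p
  have hy' := Real.rpow_nonneg hy p
  rcases le_total x y with h | h
  · calc (x + y) ^ p ≤ (2 * y) ^ p := Real.rpow_le_rpow (by linarith) (by linarith) hp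
      _ = 2 ^ p * y ^ p := Real.mul_rpow (by norm_num) hy
      _ ≤ _ := by gcongr; linarith
  · calc (x + y) ^ p ≤ (2 * x) ^ p := Real.rpow_le_rpow (by linarith) (by linarith) hp
      _ = 2 ^ p * x ^ p := Real.mul_rpow (by norm_num) hx
      _ ≤ _ := by gcongr; linarith

/-- Absorption of a small off-diagonal interaction in `ℓ^p`. -/
lemma sum_rpow_le_of_le_add {p ε : ℝ} (hp : 1 ≤ p) (hε' : ε ≤ 1 / 16)
    {a x : ℕ → ℝ} (ha : ∀ i, 0 ≤ a i) (hx : ∀ i, 0 ≤ x i) (s : Finset ℕ)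
    (h : ∀ k ∈ s, a k ≤ x k + ε * ∑ i ∈ s, (1 / 2) ^ ((i - k) + (k - i)) * a i) :
    ∑ k ∈ s, a k ^ p ≤ 2 * 2 ^ p * ∑ k ∈ s, x k ^ p := by
  have hp0 : 0 ≤ p := by linarith
  set w : ℕ → ℕ → ℝ := fun k i => (1 / 2) ^ ((i - k) + (k - i)) with hw
  have hw0 : ∀ k i, 0 ≤ w k i := fun k i => by positivity
  have hw4 : ∀ k, ∑ i ∈ s, w k i ≤ 4 := fun k => by
    refine (sum_pow_dist_le (by norm_num) (by norm_num) s k).trans ?_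
    norm_num
  have hwsymm : ∀ k i, w k i = w i k := fun k i => by simp only [hw, add_comm]
  set y : ℕ → ℝ := fun k => ∑ i ∈ s, w k i * a i with hy
  have hy0 : ∀ k, 0 ≤ y k := fun k => Finset.sum_nonneg fun i _ => mul_nonneg (hw0 k i) (ha i)
  -- Schur's test: the kernel is symmetric with row sums at most 4, so it has norm at most 4 on ℓ^p.
  have hyp : ∑ k ∈ s, y k ^ p ≤ 4 ^ p * ∑ i ∈ s, a i ^ p := by
    calc ∑ k ∈ s, y k ^ p ≤ ∑ k ∈ s, 4 ^ (p - 1) * ∑ i ∈ s, w k i * a i ^ p := by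
          refine Finset.sum_le_sum fun k _ => ?_
          refine (sum_mul_rpow_le s hp (hw0 k) ha).trans ?_
          refine mul_le_mul_of_nonneg_right ?_
            (Finset.sum_nonneg fun i _ => mul_nonneg (hw0 k i) (Real.rpow_nonneg (ha i) _))
          exact Real.rpow_le_rpow (Finset.sum_nonneg fun i _ => hw0 k i) (hw4 k) (by linarith)
      _ = 4 ^ (p - 1) * ∑ i ∈ s, (∑ k ∈ s, w i k) * a i ^ p := by
          rw [← Finset.mul_sum, Finset.sum_comm]
          congr 1
          refine Finset.sum_congr rfl fun i _ => ?_
          rw [Finset.sum_mul]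
          exact Finset.sum_congr rfl fun k _ => by rw [hwsymm]
      _ ≤ 4 ^ (p - 1) * ∑ i ∈ s, 4 * a i ^ p := by
          gcongr with i _
          · exact Real.rpow_nonneg (ha i) _
          · exact hw4 i
      _ = _ := by
          rw [← Finset.mul_sum, ← mul_assoc]
          congr 1
          rw [Real.rpow_sub_one (by norm_num)]
          norm_num
  -- The threshold 1/16 makes the total coefficient (2 · 4 / 16)^p = (1/2)^p ≤ 1/2; the sum is
  -- finite, so half of it can be absorbed.
  have h1 : ∑ k ∈ s, a k ^ p ≤ 2 ^ p * (∑ k ∈ s, x k ^ p) + 1 / 2 * ∑ k ∈ s, a k ^ p := by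
    calc ∑ k ∈ s, a k ^ p ≤ ∑ k ∈ s, 2 ^ p * (x k ^ p + (1 / 16 * y k) ^ p) := by
          refine Finset.sum_le_sum fun k hk => ?_
          refine le_trans ?_ (add_rpow_le_two_rpow_mul (hx k)
            (mul_nonneg (by norm_num) (hy0 k)) hp0)
          refine Real.rpow_le_rpow (ha k) ((h k hk).trans ?_) hp0
          exact add_le_add le_rfl (mul_le_mul_of_nonneg_right hε' (hy0 k))
      _ = 2 ^ p * (∑ k ∈ s, x k ^ p) + 2 ^ p * (1 / 16) ^ p * ∑ k ∈ s, y k ^ p := by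
          rw [← Finset.mul_sum, Finset.sum_add_distrib, mul_add, mul_assoc, Finset.mul_sum s _
            ((1 / 16 : ℝ) ^ p)]
          congr 2
          exact Finset.sum_congr rfl fun k _ => Real.mul_rpow (by norm_num) (hy0 k)
      _ ≤ 2 ^ p * (∑ k ∈ s, x k ^ p) + 2 ^ p * (1 / 16) ^ p * (4 ^ p * ∑ k ∈ s, a k ^ p) := by
          gcongr
      _ = 2 ^ p * (∑ k ∈ s, x k ^ p) + (1 / 2) ^ p * ∑ k ∈ s, a k ^ p := by
          rw [← mul_assoc, ← Real.mul_rpow (by norm_num) (by norm_num),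
            ← Real.mul_rpow (by norm_num) (by norm_num)]
          norm_num
      _ ≤ _ := by
          have : (1 / 2 : ℝ) ^ p ≤ 1 / 2 := by
            simpa using Real.rpow_le_rpow_of_exponent_ge (by norm_num) (by norm_num) hp
          have h0 : 0 ≤ ∑ k ∈ s, a k ^ p := Finset.sum_nonneg fun i _ => Real.rpow_nonneg (ha i) _
          gcongr
  linarith

lemma integral_rpow_le {p : ℝ} (hp : 1 ≤ p) {a b : ℝ} (hab : a < b) {f : ℝ → ℝ}
    (hf : Continuous f) (hf0 : ∀ x, 0 ≤ f x) :
    (∫ u in a..b, f u) ^ p ≤ (b - a) ^ (p - 1) * ∫ u in a..b, f u ^ p := by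
  have hp0 : 0 ≤ p := by linarith
  have hba : 0 < b - a := by linarith
  have hfp : Continuous fun u => f u ^ p := hf.rpow_const fun _ => Or.inr hp0
  have := (convexOn_rpow hp).map_set_average_le (μ := volume) (t := Set.Ioc a b) (f := f)
    (continuousOn_id.rpow_const fun _ _ => Or.inr hp0) isClosed_Ici
    (by simp [hab]) (by simp) (Eventually.of_forall hf0)
    (hf.integrableOn_Ioc) (by exact hfp.integrableOn_Ioc)
  rw [setAverage_eq, setAverage_eq, measureReal_def, Real.volume_Ioc,
    ENNReal.toReal_ofReal hba.le, smul_eq_mul, smul_eq_mul,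
    ← intervalIntegral.integral_of_le hab.le, ← intervalIntegral.integral_of_le hab.le,
    Real.mul_rpow (by positivity) (intervalIntegral.integral_nonneg hab.le fun u _ => hf0 u),
    Real.inv_rpow hba.le, inv_mul_le_iff₀ (by positivity)] at this
  refine this.trans (le_of_eq ?_)
  rw [Real.rpow_sub_one hba.ne']
  ring

end PowerMeans

/-! ### Two-sided estimates for the weight x^α on the half-line -/

namespace IsBlockSystem
variable {𝕜 : Type*} [RCLike 𝕜]
variable {m : ℕ → ℝ} {E : ℕ → Finset ℝ} {N : ℕ} {q r R : ℝ}

lemma scale_mul (h : IsBlockSystem m E N q r R) {x : ℝ} (hx : 0 < x) :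
    (∀ k, 0 < m k * x) ∧ ∀ k, q * (m k * x) ≤ m (k + 1) * x :=
  ⟨fun k => mul_pos (h.scale_pos k) hx, fun k => by
    rw [← mul_assoc]; exact mul_le_mul_of_nonneg_right (h.scale_gap k) hx.le⟩

/-- Upper estimate: the weighted `L^p` norm of a sum is controlled by the sizes of the blocks. -/
lemma lintegral_rpow_le (h : IsBlockSystem m E N q r R) (hr : 0 < r) {p α : ℝ} (hp : 1 ≤ p)
    (hα : -1 < α) :
    ∃ C : ℝ, 0 < C ∧ ∀ (c : ℕ → ℝ → 𝕜) (s : Finset ℕ),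
      ∫⁻ x in Set.Ioi 0, ENNReal.ofReal (‖∑ k ∈ s, expSum (E k) (c k) x‖ ^ p * x ^ α) ≤
        ENNReal.ofReal
          (C * ∑ k ∈ s, scaleMean ((α + 1) / p) (m k) (expSum (E k) (c k)) ^ p) := by
  have hp0 : 0 < p := by linarith
  set γ := (α + 1) / p with hγ
  have hγ0 : 0 < γ := div_pos (by linarith) hp0
  have hγp : γ * p = α + 1 := by rw [hγ]; field_simp
  obtain ⟨CA, hCA1, hCA⟩ := norm_expSum_le_integral 𝕜 N (R := R) hr
  have hCA0 : 0 < CA := by linarith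
  obtain ⟨W, hW0, hW⟩ := exists_sum_min_rpow_le h.one_lt hγ0
  -- The exponent γ + γ gives y^γ e^{-ry/2} ≤ C₁ y^{-γ}, so the weights are dominated by the bumps
  -- of `exists_sum_min_rpow_le`.
  obtain ⟨C₁, hC₁0, hC₁⟩ := exists_rpow_mul_exp_neg_le (η := γ + γ) (b := r / 2)
    (by positivity) (by positivity)
  set C₂ := max 1 C₁ with hC₂
  have hC₂0 : 0 < C₂ := lt_of_lt_of_le one_pos (le_max_left _ _)
  set Γ := (1 / (r / 2)) ^ γ * Real.Gamma γ with hΓ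
  have hΓ0 : 0 < Γ := mul_pos (by positivity) (Real.Gamma_pos_of_pos hγ0)
  refine ⟨CA ^ p * (C₂ * W) ^ (p - 1) * Γ, by positivity, fun c s => ?_⟩
  set A : ℕ → ℝ := fun k => scaleMean γ (m k) (expSum (E k) (c k)) with hA
  have hA0 : ∀ k, 0 ≤ A k := fun k => scaleMean_nonneg _ (h.scale_pos k).le _
  have hw : ∀ x : ℝ, 0 < x →
      ∑ k ∈ s, (m k * x) ^ γ * Real.exp (-(r / 2 * (m k * x))) ≤ C₂ * W := by
    intro x hx
    obtain ⟨hy0, hygap⟩ := h.scale_mul hx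
    refine le_trans ?_ (mul_le_mul_of_nonneg_left (hW _ hy0 hygap s) hC₂0.le)
    rw [Finset.mul_sum]
    refine Finset.sum_le_sum fun k _ => ?_
    set y := m k * x
    have hy := hy0 k
    have hyγ : 0 < y ^ γ := Real.rpow_pos_of_pos hy _
    rw [mul_min_of_nonneg _ _ hC₂0.le]
    refine le_min ?_ ?_
    · have h1 : Real.exp (-(r / 2 * y)) ≤ 1 := Real.exp_le_one_iff.2 (by
        have : 0 ≤ r / 2 * y := by positivity
        linarith)
      calc _ ≤ y ^ γ * 1 := by gcongr
        _ = 1 * y ^ γ := by ring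
        _ ≤ _ := by gcongr; exact le_max_left _ _
    · have h1 := hC₁ y hy.le
      rw [Real.rpow_add hy] at h1
      rw [Real.rpow_neg hy.le, ← div_eq_mul_inv, le_div_iff₀ hyγ]
      calc _ = y ^ γ * y ^ γ * Real.exp (-(r / 2 * y)) := by ring
        _ ≤ C₁ := h1
        _ ≤ _ := le_max_right _ _
  have hpt : ∀ x ∈ Set.Ioi (0 : ℝ), ENNReal.ofReal (‖∑ k ∈ s, expSum (E k) (c k) x‖ ^ p * x ^ α) ≤
      ∑ k ∈ s, ENNReal.ofReal (CA ^ p * (C₂ * W) ^ (p - 1) * A k ^ p * m k ^ γ) *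
        ENNReal.ofReal (x ^ (γ - 1) * Real.exp (-(r / 2 * m k * x))) := by
    intro x hx
    have hx : 0 < x := hx
    set w : ℕ → ℝ := fun k => (m k * x) ^ γ * Real.exp (-(r / 2 * (m k * x))) with hwdef
    have hw0 : ∀ k, 0 ≤ w k := fun k => by
      have := h.scale_pos k
      positivity
    -- The bound is written as a weighted sum of A k x^{-γ}, whose weights w k have bounded total.
    -- After Jensen the power x^{-γp + α} is x^{-1}, so the integral of each weight is independent
    -- of m k.
    have h1 : ‖∑ k ∈ s, expSum (E k) (c k) x‖ ≤ CA * ∑ k ∈ s, w k * (A k * x ^ (-γ)) := by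
      refine (norm_sum_le _ _).trans ?_
      rw [Finset.mul_sum]
      refine Finset.sum_le_sum fun k _ => ?_
      refine (h.norm_le hCA k (c k) x hx.le).trans (le_of_eq ?_)
      have hm := h.scale_pos k
      simp only [hwdef, hA, scaleMean]
      rw [Real.mul_rpow hm.le hx.le, Real.rpow_neg hm.le, Real.rpow_neg hx.le]
      field_simp
    have hv0 : ∀ k, 0 ≤ A k * x ^ (-γ) := fun k => mul_nonneg (hA0 k) (by positivity)
    have h2 : ‖∑ k ∈ s, expSum (E k) (c k) x‖ ^ p ≤
        CA ^ p * ((C₂ * W) ^ (p - 1) * ∑ k ∈ s, w k * (A k * x ^ (-γ)) ^ p) := by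
      have h3 : 0 ≤ ∑ k ∈ s, w k * (A k * x ^ (-γ)) :=
        Finset.sum_nonneg fun k _ => mul_nonneg (hw0 k) (hv0 k)
      have h4 : 0 ≤ ∑ k ∈ s, w k * (A k * x ^ (-γ)) ^ p :=
        Finset.sum_nonneg fun k _ => mul_nonneg (hw0 k) (Real.rpow_nonneg (hv0 k) _)
      refine (Real.rpow_le_rpow (norm_nonneg _) h1 hp0.le).trans ?_
      rw [Real.mul_rpow hCA0.le h3]
      gcongr
      refine (sum_mul_rpow_le s hp hw0 hv0).trans ?_
      refine mul_le_mul_of_nonneg_right ?_ h4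
      exact Real.rpow_le_rpow (Finset.sum_nonneg fun k _ => hw0 k) (hw x hx) (by linarith)
    have h5 : ∀ k, 0 ≤ CA ^ p * (C₂ * W) ^ (p - 1) * A k ^ p * m k ^ γ := fun k => by
      have := hA0 k
      have := h.scale_pos k
      positivity
    simp only [← ENNReal.ofReal_mul (h5 _)]
    rw [← ENNReal.ofReal_sum_of_nonneg]
    · refine ENNReal.ofReal_le_ofReal ?_
      refine (mul_le_mul_of_nonneg_right h2 (by positivity)).trans (le_of_eq ?_)
      rw [← mul_assoc, Finset.mul_sum, Finset.sum_mul]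
      refine Finset.sum_congr rfl fun k _ => ?_
      have hm := h.scale_pos k
      simp only [hwdef]
      rw [Real.mul_rpow hm.le hx.le, Real.mul_rpow (hA0 k) (by positivity), ← Real.rpow_mul hx.le,
        show -γ * p = -1 - α by linarith, Real.rpow_sub hx, Real.rpow_neg_one,
        Real.rpow_sub_one hx.ne', show r / 2 * (m k * x) = r / 2 * m k * x by ring]
      have : x ^ α ≠ 0 := by positivity
      field_simp
    · intro k _
      exact mul_nonneg (h5 k) (mul_nonneg (Real.rpow_nonneg hx.le _) (Real.exp_pos _).le)
  refine (setLIntegral_mono' measurableSet_Ioi hpt).trans (le_of_eq ?_)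
  rw [lintegral_finsetSum _ (fun k _ => by fun_prop), Finset.mul_sum,
    ENNReal.ofReal_sum_of_nonneg (fun k _ => by have := hA0 k; positivity)]
  refine Finset.sum_congr rfl fun k _ => ?_
  have hm := h.scale_pos k
  have hrm : 0 < r / 2 * m k := by positivity
  rw [lintegral_const_mul _ (by fun_prop), ← ofReal_integral_eq_lintegral_ofReal]
  · rw [Real.integral_rpow_mul_exp_neg_mul_Ioi hγ0 hrm, ← ENNReal.ofReal_mul
      (by have := hA0 k; positivity)]
    congr 1
    rw [one_div, mul_inv,
      Real.mul_rpow (x := (r / 2)⁻¹) (by positivity) (by positivity), Real.inv_rpow hm.le, hΓ,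
      one_div]
    have : m k ^ γ ≠ 0 := by positivity
    simp only [hA]
    field_simp
  · have := integrableOn_rpow_mul_exp_neg_mul_rpow (p := 1) (s := γ - 1) (b := r / 2 * m k)
      (by linarith) one_pos hrm
    simpa [IntegrableOn] using this
  · filter_upwards [ae_restrict_mem measurableSet_Ioi] with x hx
    have hx : 0 < x := hx
    positivity

/-- Lower estimate: the sizes of the blocks are controlled by the weighted `L^p` norm of
the sum. -/
lemma sum_scaleMean_rpow_le (h : IsBlockSystem m E N q 1 R)
    (hsep : ∀ i k, i < k → ∀ μ ∈ E i, ∀ ν ∈ E k, q * μ ≤ ν) {p α : ℝ} (hp : 1 ≤ p)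
    (hα : -1 < α) :
    ∃ C : ℝ, 0 < C ∧ ∀ (c : ℕ → ℝ → 𝕜) (s : Finset ℕ),
      ENNReal.ofReal (∑ k ∈ s, scaleMean ((α + 1) / p) (m k) (expSum (E k) (c k)) ^ p) ≤
        ENNReal.ofReal C *
          ∫⁻ x in Set.Ioi 0, ENNReal.ofReal (‖∑ k ∈ s, expSum (E k) (c k) x‖ ^ p * x ^ α) := by
  have hp0 : 0 < p := by linarith
  set γ := (α + 1) / p with hγ
  have hγ0 : 0 < γ := div_pos (by linarith) hp0
  have hγp : γ * p = α + 1 := by rw [hγ]; field_simp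
  obtain ⟨C, hC0, hC⟩ := h.scaleMean_le (𝕜 := 𝕜) hsep hγ0
  obtain ⟨M, hM⟩ : ∃ M : ℕ, C * (1 / 2) ^ M ≤ 1 / 16 := by
    obtain ⟨M, hM⟩ := exists_pow_lt_of_lt_one (show 0 < 1 / 16 / C by positivity)
      (show (1 / 2 : ℝ) < 1 by norm_num)
    rw [lt_div_iff₀ hC0] at hM
    exact ⟨M, by linarith⟩
  obtain ⟨B, Y₀, hB0, hY₀, hBY⟩ := hC M
  -- Enlarging Y₀ keeps the interval (1, Y) nondegenerate, as Jensen requires; κ below is a lower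
  -- bound for y^α on [1, Y] whatever the sign of α.
  set Y := Y₀ + 1 with hY
  have hY1 : 1 < Y := by linarith
  obtain ⟨W, hW0, hW⟩ := exists_sum_min_rpow_le h.one_lt one_pos
  set κ := min 1 (Y ^ α) with hκ
  have hκ0 : 0 < κ := lt_min one_pos (by positivity)
  set D := B ^ p * ((Y - 1) ^ (p - 1) * κ⁻¹) with hD
  have hY10 : 0 < Y - 1 := by linarith
  have hD0 : 0 ≤ D := by positivity
  refine ⟨2 * 2 ^ p * (D + 1) * (Y * W), by positivity, fun c s => ?_⟩
  set F : ℝ → 𝕜 := fun x => ∑ k ∈ s, expSum (E k) (c k) x with hF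
  have hFc : Continuous F := continuous_finsetSum _ fun i _ => continuous_expSum _ _
  have hFp : Continuous fun x => ‖F x‖ ^ p := hFc.norm.rpow_const fun _ => Or.inr hp0.le
  set X : ℕ → ℝ := fun k => B * (m k ^ (-γ) * ∫ u in (1 : ℝ)..Y, ‖F (u / m k)‖) with hX
  have hint0 : ∀ k, 0 ≤ ∫ u in (1 : ℝ)..Y, ‖F (u / m k)‖ := fun k =>
    intervalIntegral.integral_nonneg hY1.le fun _ _ => norm_nonneg _
  have hX0 : ∀ k, 0 ≤ X k := fun k => by
    have := h.scale_pos k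
    have := hint0 k
    positivity
  have habs := sum_rpow_le_of_le_add hp hM
    (a := fun k => scaleMean γ (m k) (expSum (E k) (c k)))
    (fun k => scaleMean_nonneg _ (h.scale_pos k).le _) hX0 s (by
      intro k hk
      refine (hBY c s k hk).trans (add_le_add ?_ le_rfl)
      have := h.scale_pos k
      simp only [hX]
      gcongr
      exact intervalIntegral.integral_mono_interval le_rfl hY₀ (by linarith)
        (Eventually.of_forall fun u => norm_nonneg _)
        ((by fun_prop : Continuous fun u => ‖F (u / m k)‖).intervalIntegrable _ _))
  set Φ : ℝ → ℝ := fun x => ‖F x‖ ^ p * x ^ α with hΦ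
  have hΦm : Measurable Φ := hFp.measurable.mul (by fun_prop)
  have hXk : ∀ k, X k ^ p ≤ D * ∫ x in (1 / m k)..(Y / m k), Φ x := by
    intro k
    have hm := h.scale_pos k
    have h1 := integral_rpow_le hp hY1 (f := fun u => ‖F (u / m k)‖) (by fun_prop)
      (fun _ => norm_nonneg _)
    rw [intervalIntegral.integral_comp_div (fun x => ‖F x‖ ^ p) hm.ne', smul_eq_mul] at h1
    have hle : 1 / m k ≤ Y / m k := by gcongr
    have h2 : κ * m k ^ (-α) * ∫ x in (1 / m k)..(Y / m k), ‖F x‖ ^ p ≤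
        ∫ x in (1 / m k)..(Y / m k), Φ x := by
      rw [← intervalIntegral.integral_const_mul]
      apply intervalIntegral.integral_mono_on hle
      · exact (continuous_const.mul hFp).intervalIntegrable _ _
      · apply ContinuousOn.intervalIntegrable
        refine hFp.continuousOn.mul (continuousOn_id.rpow_const fun x hx => Or.inl ?_)
        rw [Set.uIcc_of_le hle] at hx
        exact ((show 0 < 1 / m k by positivity).trans_le hx.1).ne'
      · intro x hx
        have hx0 : 0 < x := (show 0 < 1 / m k by positivity).trans_le hx.1
        have h3 : 1 ≤ m k * x := by have := hx.1; rw [div_le_iff₀ hm] at this; linarith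
        have h4 : m k * x ≤ Y := by have := hx.2; rw [le_div_iff₀ hm] at this; linarith
        have h5 : κ ≤ (m k * x) ^ α := by
          rcases le_total 0 α with ha | ha
          · exact (min_le_left _ _).trans (Real.one_le_rpow h3 ha)
          · exact (min_le_right _ _).trans
              (Real.rpow_le_rpow_of_nonpos (by positivity) h4 ha)
        have h6 : κ * m k ^ (-α) ≤ x ^ α := by
          rw [Real.mul_rpow hm.le hx0.le] at h5
          rw [Real.rpow_neg hm.le, ← div_eq_mul_inv, div_le_iff₀ (by positivity)]
          linarith
        rw [mul_comm]
        exact mul_le_mul_of_nonneg_left h6 (by positivity)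
    set J := ∫ x in (1 / m k)..(Y / m k), ‖F x‖ ^ p with hJ
    -- Since γ p = α + 1, the normalisation pays for the weight, m^{-α}, and for the Jacobian m of
    -- the dilation.
    have h7 : (m k ^ (-γ)) ^ p = m k ^ (-α) * (m k)⁻¹ := by
      rw [← Real.rpow_mul hm.le, show -γ * p = -α - 1 by linarith, Real.rpow_sub_one hm.ne']
      rfl
    calc X k ^ p = B ^ p * ((m k ^ (-γ)) ^ p * (∫ u in (1 : ℝ)..Y, ‖F (u / m k)‖) ^ p) := by
          simp only [hX]
          rw [Real.mul_rpow hB0 (mul_nonneg (by positivity) (hint0 k)),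
            Real.mul_rpow (by positivity) (hint0 k)]
      _ ≤ B ^ p * ((m k ^ (-γ)) ^ p * ((Y - 1) ^ (p - 1) * (m k * J))) := by gcongr
      _ = D * (κ * m k ^ (-α) * J) := by
          rw [h7, hD]; field_simp
      _ ≤ _ := by gcongr
  have hXE : ∀ k, ENNReal.ofReal (X k ^ p) ≤ ENNReal.ofReal (D + 1) *
      ∫⁻ x in Set.Ioi 0, (Set.Ioc (1 / m k) (Y / m k)).indicator
        (fun x => ENNReal.ofReal (Φ x)) x := by
    intro k
    have hm := h.scale_pos k
    have hle : 1 / m k ≤ Y / m k := by gcongr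
    have hsub : Set.Ioc (1 / m k) (Y / m k) ⊆ Set.Ioi 0 := fun x hx =>
      (show 0 < 1 / m k by positivity).trans hx.1
    rw [lintegral_indicator measurableSet_Ioc, Measure.restrict_restrict measurableSet_Ioc,
      Set.inter_eq_left.2 hsub]
    have hI : IntegrableOn Φ (Set.Ioc (1 / m k) (Y / m k)) := by
      refine (ContinuousOn.integrableOn_Icc ?_).mono_set Set.Ioc_subset_Icc_self
      refine hFp.continuousOn.mul (continuousOn_id.rpow_const fun x hx => Or.inl ?_)
      exact ((show 0 < 1 / m k by positivity).trans_le hx.1).ne'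
    rw [← ofReal_integral_eq_lintegral_ofReal hI, ← intervalIntegral.integral_of_le hle,
      ← ENNReal.ofReal_mul (by positivity)]
    · refine ENNReal.ofReal_le_ofReal ((hXk k).trans ?_)
      have : 0 ≤ ∫ x in (1 / m k)..(Y / m k), Φ x := by
        apply intervalIntegral.integral_nonneg hle
        intro x hx
        have hx0 : 0 < x := (show 0 < 1 / m k by positivity).trans_le hx.1
        simp only [hΦ]
        positivity
      gcongr
      linarith
    · filter_upwards [ae_restrict_mem measurableSet_Ioc] with x hx
      have hx0 : 0 < x := hsub hx
      simp only [hΦ, Pi.zero_apply]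
      positivity
  -- The windows (1 / m k, Y / m k] overlap boundedly: on 1 ≤ y ≤ Y the indicator is at most Y
  -- min(y, 1/y), and these bumps are summable uniformly.
  have hoverlap : ∀ x ∈ Set.Ioi (0 : ℝ),
      ∑ k ∈ s, (Set.Ioc (1 / m k) (Y / m k)).indicator (fun x => ENNReal.ofReal (Φ x)) x ≤
        ENNReal.ofReal (Y * W) * ENNReal.ofReal (Φ x) := by
    intro x hx
    have hx : 0 < x := hx
    obtain ⟨hy0, hygap⟩ := h.scale_mul hx
    calc _ ≤ ∑ k ∈ s, ENNReal.ofReal (Y * min ((m k * x) ^ (1 : ℝ)) ((m k * x) ^ (-1 : ℝ))) *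
            ENNReal.ofReal (Φ x) := by
          refine Finset.sum_le_sum fun k _ => ?_
          rw [Set.indicator_apply]
          split_ifs with hk
          · refine le_mul_of_one_le_left zero_le ?_
            rw [ENNReal.one_le_ofReal]
            have hm := h.scale_pos k
            have h3 : 1 ≤ m k * x := by have := hk.1.le; rw [div_le_iff₀ hm] at this; linarith
            have h4 : m k * x ≤ Y := by have := hk.2; rw [le_div_iff₀ hm] at this; linarith
            rw [mul_min_of_nonneg _ _ (by linarith), Real.rpow_one, Real.rpow_neg_one]
            refine le_min (by nlinarith) ?_
            rw [← div_eq_mul_inv, le_div_iff₀ (hy0 k)]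
            linarith
          · exact zero_le
      _ = ENNReal.ofReal (∑ k ∈ s, Y * min ((m k * x) ^ (1 : ℝ)) ((m k * x) ^ (-1 : ℝ))) *
            ENNReal.ofReal (Φ x) := by
          rw [← Finset.sum_mul, ENNReal.ofReal_sum_of_nonneg]
          intro k _
          have := hy0 k
          positivity
      _ ≤ _ := by
          gcongr
          rw [← Finset.mul_sum]
          gcongr
          exact hW _ hy0 hygap s
  calc _ ≤ ENNReal.ofReal (2 * 2 ^ p * ∑ k ∈ s, X k ^ p) := ENNReal.ofReal_le_ofReal habs
    _ = ENNReal.ofReal (2 * 2 ^ p) * ∑ k ∈ s, ENNReal.ofReal (X k ^ p) := by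
        rw [ENNReal.ofReal_mul (by positivity), ENNReal.ofReal_sum_of_nonneg]
        intro k _
        have := hX0 k
        positivity
    _ ≤ ENNReal.ofReal (2 * 2 ^ p) * ∑ k ∈ s, ENNReal.ofReal (D + 1) *
          ∫⁻ x in Set.Ioi 0, (Set.Ioc (1 / m k) (Y / m k)).indicator
            (fun x => ENNReal.ofReal (Φ x)) x := by
        gcongr with k _
        exact hXE k
    _ = ENNReal.ofReal (2 * 2 ^ p) * (ENNReal.ofReal (D + 1) * ∫⁻ x in Set.Ioi 0,
          ∑ k ∈ s, (Set.Ioc (1 / m k) (Y / m k)).indicator (fun x => ENNReal.ofReal (Φ x)) x) := by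
        rw [← Finset.mul_sum, lintegral_finsetSum]
        intro k _
        exact hΦm.ennreal_ofReal.indicator measurableSet_Ioc
    _ ≤ ENNReal.ofReal (2 * 2 ^ p) * (ENNReal.ofReal (D + 1) * ∫⁻ x in Set.Ioi 0,
          ENNReal.ofReal (Y * W) * ENNReal.ofReal (Φ x)) := by
        refine mul_le_mul_right (mul_le_mul_right ?_ _) _
        exact setLIntegral_mono' measurableSet_Ioi hoverlap
    _ = _ := by
        rw [lintegral_const_mul _ hΦm.ennreal_ofReal, ← mul_assoc, ← mul_assoc,
          ← ENNReal.ofReal_mul (by positivity), ← ENNReal.ofReal_mul (by positivity)]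

end IsBlockSystem

/-! ### The substitution t = e^{-x} -/

section ChangeOfVariables
variable {𝕜 : Type*} [RCLike 𝕜]

lemma image_exp_neg_Ioi : (fun x : ℝ => Real.exp (-x)) '' Set.Ioi 0 = Set.Ioo 0 1 := by
  ext t
  constructor
  · rintro ⟨x, hx, rfl⟩
    have hx : 0 < x := hx
    refine ⟨Real.exp_pos _, ?_⟩
    have := Real.exp_lt_exp.2 (neg_lt_zero.2 hx)
    rwa [Real.exp_zero] at this
  · rintro ⟨h0, h1⟩
    refine ⟨-Real.log t, ?_, by simp [Real.exp_log h0]⟩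
    have := Real.log_neg h0 h1
    simpa using this

lemma nuNorm_rpow_eq {p : ℝ} (hp : 0 < p) (α : ℝ) (f : ℝ → 𝕜) :
    nuNorm p α f ^ p = ∫⁻ x in Set.Ioi 0,
      ENNReal.ofReal (‖f (Real.exp (-x))‖ ^ p * ((1 - Real.exp (-x)) ^ α * Real.exp (-x))) := by
  have hp' : ENNReal.ofReal p ≠ 0 := by simpa using hp
  rw [nuNorm, eLpNorm_eq_lintegral_rpow_enorm_toReal hp' ENNReal.ofReal_ne_top,
    ENNReal.toReal_ofReal hp.le, ← ENNReal.rpow_mul, one_div_mul_cancel hp.ne', ENNReal.rpow_one,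
    nuMeasure, lintegral_withDensity_eq_lintegral_mul_non_measurable _ (by fun_prop)
      (Eventually.of_forall fun _ => ENNReal.ofReal_lt_top),
    ← Measure.restrict_congr_set Ioo_ae_eq_Icc, ← image_exp_neg_Ioi,
    lintegral_image_eq_lintegral_abs_deriv_mul (f' := fun x => -Real.exp (-x)) measurableSet_Ioi]
  · refine setLIntegral_congr_fun measurableSet_Ioi fun x hx => ?_
    have hx : 0 < x := hx
    have h1 : 0 ≤ 1 - Real.exp (-x) := by
      rw [sub_nonneg]; exact Real.exp_le_one_iff.2 (by linarith)
    simp only [Pi.mul_apply]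
    rw [abs_neg, abs_of_pos (Real.exp_pos _), ← ofReal_norm,
      ENNReal.ofReal_rpow_of_nonneg (norm_nonneg _) hp.le,
      ← ENNReal.ofReal_mul (by positivity), ← ENNReal.ofReal_mul (by positivity)]
    congr 1; ring
  · intro x _
    have := ((hasDerivAt_id x).neg.exp).hasDerivWithinAt (s := Set.Ioi 0)
    simpa using this
  · intro x _ y _ hxy
    simpa using hxy

/-- Everything rests on x e^{-x} ≤ 1 - e^{-x} ≤ x. For α ≤ 0 the lower bound produces e^{-(1+α)x},
which is at most 1 because α > -1. -/
lemma weight_le {α x : ℝ} (hα : -1 < α) (hx : 0 < x) :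
    (1 - Real.exp (-x)) ^ α * Real.exp (-x) ≤ x ^ α := by
  have h1 : 1 - Real.exp (-x) ≤ x := by linarith [Real.add_one_le_exp (-x)]
  have h2 : x * Real.exp (-x) ≤ 1 - Real.exp (-x) := by
    have h3 : Real.exp x * Real.exp (-x) = 1 := by rw [← Real.exp_add]; simp
    nlinarith [Real.add_one_le_exp x, Real.exp_pos (-x)]
  have h3 : 0 < x * Real.exp (-x) := mul_pos hx (Real.exp_pos _)
  have h4 : Real.exp (-x) ≤ 1 := Real.exp_le_one_iff.2 (by linarith)
  rcases le_total 0 α with ha | ha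
  · calc _ ≤ x ^ α * 1 := by
          gcongr
      _ = _ := mul_one _
  · calc _ ≤ (x * Real.exp (-x)) ^ α * Real.exp (-x) := by
          refine mul_le_mul_of_nonneg_right ?_ (Real.exp_pos _).le
          exact Real.rpow_le_rpow_of_nonpos h3 h2 ha
      _ = x ^ α * Real.exp (-((1 + α) * x)) := by
          rw [Real.mul_rpow hx.le (Real.exp_pos _).le, ← Real.exp_mul, mul_assoc, ← Real.exp_add]
          congr 2; ring
      _ ≤ x ^ α * 1 := by
          gcongr
          exact Real.exp_le_one_iff.2 (by nlinarith)
      _ = _ := mul_one _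

lemma le_weight {α x : ℝ} (hx : 0 < x) :
    x ^ α * Real.exp (-((1 + |α|) * x)) ≤ (1 - Real.exp (-x)) ^ α * Real.exp (-x) := by
  have h1 : 1 - Real.exp (-x) ≤ x := by linarith [Real.add_one_le_exp (-x)]
  have h2 : x * Real.exp (-x) ≤ 1 - Real.exp (-x) := by
    have h3 : Real.exp x * Real.exp (-x) = 1 := by rw [← Real.exp_add]; simp
    nlinarith [Real.add_one_le_exp x, Real.exp_pos (-x)]
  have h3 : 0 < x * Real.exp (-x) := mul_pos hx (Real.exp_pos _)
  rcases le_total 0 α with ha | ha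
  · calc _ = (x * Real.exp (-x)) ^ α * Real.exp (-x) := by
          rw [Real.mul_rpow hx.le (Real.exp_pos _).le, ← Real.exp_mul, mul_assoc, ← Real.exp_add,
            abs_of_nonneg ha]
          congr 2; ring
      _ ≤ _ := by gcongr
  · calc _ ≤ x ^ α * Real.exp (-x) := by
          gcongr
          nlinarith [abs_nonneg α]
      _ ≤ _ := by
          refine mul_le_mul_of_nonneg_right ?_ (Real.exp_pos _).le
          exact Real.rpow_le_rpow_of_nonpos (by linarith) h1 ha

lemma nuNorm_rpow_le {p α : ℝ} (hp : 0 < p) (hα : -1 < α) (f : ℝ → 𝕜) :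
    nuNorm p α f ^ p ≤
      ∫⁻ x in Set.Ioi 0, ENNReal.ofReal (‖f (Real.exp (-x))‖ ^ p * x ^ α) := by
  rw [nuNorm_rpow_eq hp]
  refine setLIntegral_mono' measurableSet_Ioi fun x hx => ENNReal.ofReal_le_ofReal ?_
  gcongr
  exact weight_le hα hx

/-- The loss in the weight is moved onto f as multiplication by e^{-bx}, which on exponential sums
is a translation of the exponents. -/
lemma le_nuNorm_rpow {p : ℝ} (hp : 0 < p) (α : ℝ) (f : ℝ → 𝕜) :
    ∫⁻ x in Set.Ioi 0, ENNReal.ofReal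
      ((Real.exp (-((1 + |α|) / p * x)) * ‖f (Real.exp (-x))‖) ^ p * x ^ α) ≤
      nuNorm p α f ^ p := by
  rw [nuNorm_rpow_eq hp]
  refine setLIntegral_mono' measurableSet_Ioi fun x hx => ENNReal.ofReal_le_ofReal ?_
  rw [Real.mul_rpow (Real.exp_pos _).le (norm_nonneg _), ← Real.exp_mul,
    show -((1 + |α|) / p * x) * p = -((1 + |α|) * x) by field_simp]
  calc _ = ‖f (Real.exp (-x))‖ ^ p * (x ^ α * Real.exp (-((1 + |α|) * x))) := by ring
    _ ≤ _ := mul_le_mul_of_nonneg_left (le_weight hx) (by positivity)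

end ChangeOfVariables

/-! ### Decoupling for blocks of bounded ratio -/

section QuasiLacunary
variable {𝕜 : Type*} [RCLike 𝕜] {Λ : ℕ → ℝ} {n : ℕ → ℕ} {N : ℕ} {q : ℝ}

/-- The block `E_k` as a finite set. -/
noncomputable def expBlockFinset (Λ : ℕ → ℝ) (n : ℕ → ℕ) (k : ℕ) : Finset ℝ :=
  (Finset.Ico (n k) (n (k + 1))).image Λ

lemma coe_expBlockFinset (k : ℕ) : (expBlockFinset Λ n k : Set ℝ) = expBlock Λ n k := by
  simp [expBlockFinset, expBlock]

lemma expSum_shift (A : Finset ℝ) (c : ℝ → 𝕜) (b x : ℝ) :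
    expSum (A.image (· + b)) (fun ν => c (ν - b)) x =
      ((Real.exp (-(b * x)) : ℝ) : 𝕜) * expSum A c x := by
  unfold expSum
  rw [Finset.sum_image (by intro x _ y _ h; simpa using h), Finset.mul_sum]
  refine Finset.sum_congr rfl fun μ _ => ?_
  simp only [add_sub_cancel_right]
  rw [show -((μ + b) * x) = -(b * x) + -(μ * x) by ring, Real.exp_add]
  push_cast; ring

lemma exists_expSum_of_mem_blockSpace {k : ℕ} {f : ℝ → 𝕜} (hf : f ∈ blockSpace 𝕜 Λ n k) :
    ∃ c : ℝ → 𝕜, ∀ t, f t = ∑ μ ∈ expBlockFinset Λ n k, c μ * ((t ^ μ : ℝ) : 𝕜) := by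
  rw [blockSpace, ← coe_expBlockFinset] at hf
  refine Submodule.span_induction (p := fun f _ => ∃ c : ℝ → 𝕜, ∀ t, f t =
    ∑ μ ∈ expBlockFinset Λ n k, c μ * ((t ^ μ : ℝ) : 𝕜)) ?_ ?_ ?_ ?_ hf
  · rintro _ ⟨ν, hν, rfl⟩
    classical
    refine ⟨fun μ => if μ = ν then 1 else 0, fun t => ?_⟩
    simp only [ite_mul, one_mul, zero_mul, Finset.sum_ite_eq', Finset.mem_coe.1 hν, if_true]
  · exact ⟨0, by simp⟩
  · rintro f g - - ⟨c, hc⟩ ⟨d, hd⟩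
    exact ⟨c + d, fun t => by simp [hc, hd, add_mul, Finset.sum_add_distrib]⟩
  · rintro a f - ⟨c, hc⟩
    exact ⟨a • c, fun t => by simp [hc, Finset.mul_sum, mul_assoc]⟩

namespace IsQuasiLacunary

lemma mem_lower (h : IsQuasiLacunary Λ n N q) {k : ℕ} {μ : ℝ} (hμ : μ ∈ expBlockFinset Λ n k) :
    Λ (n k) ≤ μ := by
  obtain ⟨j, hj, rfl⟩ := Finset.mem_image.1 hμ
  exact h.strictMono.monotone (Finset.mem_Ico.1 hj).1

lemma first_mem (h : IsQuasiLacunary Λ n N q) (k : ℕ) : Λ (n k) ∈ expBlockFinset Λ n k :=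
  Finset.mem_image_of_mem _ (Finset.mem_Ico.2 ⟨le_rfl, h.cut_strictMono (Nat.lt_succ_self k)⟩)

lemma zero_le_first (h : IsQuasiLacunary Λ n N q) (k : ℕ) : Λ 0 ≤ Λ (n k) :=
  h.strictMono.monotone (Nat.zero_le _)

lemma gap' (h : IsQuasiLacunary Λ n N q) {i k : ℕ} (hik : i < k) {μ ν : ℝ}
    (hμ : μ ∈ expBlockFinset Λ n i) (hν : ν ∈ expBlockFinset Λ n k) : q * μ ≤ ν := by
  have h1 : q * μ ≤ Λ (n (i + 1)) := h.gap i μ (by rwa [← coe_expBlockFinset])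
    _ (by rw [← coe_expBlockFinset]; exact h.first_mem _)
  refine h1.trans ((h.strictMono.monotone (h.cut_strictMono.monotone hik)).trans (h.mem_lower hν))

lemma card_expBlockFinset_le (h : IsQuasiLacunary Λ n N q) (k : ℕ) :
    (expBlockFinset Λ n k).card ≤ N := by
  rw [← Set.ncard_coe_finset, coe_expBlockFinset]
  exact h.card_le k

/-- A translation of the exponents preserves multiplicative gaps. -/
lemma shifted_gap (h : IsQuasiLacunary Λ n N q) {b x y : ℝ} (hb : 0 < b) (hx : Λ 0 ≤ x)
    (hxy : q * x ≤ y) : (q * Λ 0 + b) / (Λ 0 + b) * (x + b) ≤ y + b := by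
  have h0 := h.pos 0
  have hq := h.one_lt
  rw [div_mul_eq_mul_div, div_le_iff₀ (by positivity)]
  -- The quotient (q x + b) / (x + b) increases with x, so the least exponent Λ 0 gives the worst
  -- gap; this product is the exact difference.
  have h1 : 0 ≤ b * ((q - 1) * (x - Λ 0)) :=
    mul_nonneg hb.le (mul_nonneg (by linarith) (by linarith))
  have h2 : (q * x + b) * (Λ 0 + b) ≤ (y + b) * (Λ 0 + b) := by gcongr
  nlinarith

lemma one_lt_shifted (h : IsQuasiLacunary Λ n N q) {b : ℝ} (hb : 0 < b) :
    1 < (q * Λ 0 + b) / (Λ 0 + b) := by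
  have h0 := h.pos 0
  rw [one_lt_div (by positivity)]
  nlinarith [h.one_lt]

variable {K : ℝ}

/-- The scale contains b although the exponents are not translated: the upper and lower estimates
must measure blocks at the same scale. -/
lemma isBlockSystem (h : IsQuasiLacunary Λ n N q)
    (hK : ∀ k, ∀ μ ∈ expBlockFinset Λ n k, μ ≤ K * Λ (n k)) {b : ℝ} (hb : 0 < b) :
    IsBlockSystem (fun k => Λ (n k) + b) (expBlockFinset Λ n) N ((q * Λ 0 + b) / (Λ 0 + b))
      (Λ 0 / (Λ 0 + b)) K where
  one_lt := h.one_lt_shifted hb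
  scale_pos k := add_pos (h.pos _) hb
  scale_gap k := h.shifted_gap hb (h.zero_le_first k)
    (h.gap' (Nat.lt_succ_self k) (h.first_mem k) (h.first_mem _))
  card_le := h.card_expBlockFinset_le
  mem_bounds k μ hμ := by
    have h0 := h.pos 0
    have h1 := h.mem_lower hμ
    have h2 := h.zero_le_first k
    have h3 := hK k μ hμ
    have h4 : 0 ≤ K := by
      by_contra! hneg
      have := mul_neg_of_neg_of_pos hneg (h.pos (n k))
      linarith [h.pos (n k)]
    refine ⟨?_, by nlinarith⟩
    rw [div_mul_eq_mul_div, div_le_iff₀ (by positivity)]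
    nlinarith

/-- After translation the least exponent of a block equals its scale, giving the lower constant 1 on
which `scaleMean_le` relies. -/
lemma isBlockSystem_shift (h : IsQuasiLacunary Λ n N q)
    (hK : ∀ k, ∀ μ ∈ expBlockFinset Λ n k, μ ≤ K * Λ (n k)) {b : ℝ} (hb : 0 < b) :
    IsBlockSystem (fun k => Λ (n k) + b) (fun k => (expBlockFinset Λ n k).image (· + b)) N
      ((q * Λ 0 + b) / (Λ 0 + b)) 1 K where
  one_lt := h.one_lt_shifted hb
  scale_pos k := add_pos (h.pos _) hb
  scale_gap k := (h.isBlockSystem hK hb).scale_gap k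
  card_le k := Finset.card_image_le.trans (h.card_expBlockFinset_le k)
  mem_bounds k μ hμ := by
    obtain ⟨ν, hν, rfl⟩ := Finset.mem_image.1 hμ
    have h1 := h.mem_lower hν
    have h2 := hK k ν hν
    have h3 : 1 ≤ K := by
      by_contra! hneg
      have h4 := hK k _ (h.first_mem k)
      nlinarith [h.pos (n k)]
    constructor
    · linarith
    · nlinarith

/-- Decoupling of finite sums when the blocks have bounded ratio. -/
lemma exists_decoupling_of_ratio_le (𝕜 : Type*) [RCLike 𝕜] (h : IsQuasiLacunary Λ n N q)
    (hK : ∀ k, ∀ μ ∈ expBlockFinset Λ n k, μ ≤ K * Λ (n k)) {p α : ℝ} (hp : 1 ≤ p)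
    (hα : -1 < α) :
    ∃ C : ℝ, 0 < C ∧ ∀ f : ℕ → ℝ → 𝕜, (∀ k, f k ∈ blockSpace 𝕜 Λ n k) → ∀ s : Finset ℕ,
      nuNorm p α (∑ k ∈ s, f k) ^ p ≤ ENNReal.ofReal C * ∑ k ∈ s, nuNorm p α (f k) ^ p ∧
      ∑ k ∈ s, nuNorm p α (f k) ^ p ≤ ENNReal.ofReal C * nuNorm p α (∑ k ∈ s, f k) ^ p := by
  have hp0 : 0 < p := by linarith
  set b := (1 + |α|) / p with hb
  have hb0 : 0 < b := by positivity
  set γ := (α + 1) / p with hγ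
  set m : ℕ → ℝ := fun k => Λ (n k) + b with hm
  have hr : 0 < Λ 0 / (Λ 0 + b) := div_pos (h.pos 0) (add_pos (h.pos 0) hb0)
  have hm0 : ∀ k, 0 < m k := fun k => add_pos (h.pos _) hb0
  have hsep : ∀ i k, i < k → ∀ μ ∈ (expBlockFinset Λ n i).image (· + b),
      ∀ ν ∈ (expBlockFinset Λ n k).image (· + b), (q * Λ 0 + b) / (Λ 0 + b) * μ ≤ ν := by
    intro i k hik μ hμ ν hν
    obtain ⟨x, hx, rfl⟩ := Finset.mem_image.1 hμ
    obtain ⟨y, hy, rfl⟩ := Finset.mem_image.1 hν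
    exact h.shifted_gap hb0 ((h.zero_le_first i).trans (h.mem_lower hx)) (h.gap' hik hx hy)
  obtain ⟨C₁, hC₁, hU⟩ := (h.isBlockSystem hK hb0).lintegral_rpow_le (𝕜 := 𝕜) hr hp hα
  obtain ⟨C₂, hC₂, hL⟩ := (h.isBlockSystem_shift hK hb0).sum_scaleMean_rpow_le (𝕜 := 𝕜) hsep hp hα
  refine ⟨C₁ * Real.exp 2 ^ p * C₂, by positivity, fun f hf s => ?_⟩
  choose c hc using fun k => exists_expSum_of_mem_blockSpace (hf k)
  have hfc : ∀ k x, f k (Real.exp (-x)) = expSum (expBlockFinset Λ n k) (c k) x := by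
    intro k x
    rw [hc, expSum]
    refine Finset.sum_congr rfl fun μ _ => ?_
    rw [← Real.exp_mul, show -x * μ = -(μ * x) by ring]
  set c' : ℕ → ℝ → 𝕜 := fun k ν => c k (ν - b) with hc'
  set A : ℕ → ℝ := fun k => scaleMean γ (m k) (expSum (expBlockFinset Λ n k) (c k)) with hA
  set A' : ℕ → ℝ := fun k =>
    scaleMean γ (m k) (expSum ((expBlockFinset Λ n k).image (· + b)) (c' k)) with hA'
  have hA0 : ∀ k, 0 ≤ A k := fun k => scaleMean_nonneg _ (hm0 k).le _
  have hA'0 : ∀ k, 0 ≤ A' k := fun k => scaleMean_nonneg _ (hm0 k).le _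
  -- The means only see x = u / m k with u ≤ 2, where b x ≤ 2 because m k ≥ b; so the factor e^{-bx}
  -- costs at most e².
  have hAA' : ∀ k, A k ≤ Real.exp 2 * A' k := by
    intro k
    have hmk := hm0 k
    simp only [hA, hA', scaleMean]
    rw [mul_left_comm]
    gcongr
    rw [← intervalIntegral.integral_const_mul]
    apply intervalIntegral.integral_mono_on (by norm_num)
    · exact ((continuous_expSum _ _).comp (continuous_id.div_const _)).norm.intervalIntegrable _ _
    · exact (continuous_const.mul ((continuous_expSum _ _).comp
        (continuous_id.div_const _)).norm).intervalIntegrable _ _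
    · intro u hu
      simp only [hc', expSum_shift, norm_mul, norm_ofReal_exp]
      rw [← mul_assoc, ← Real.exp_add]
      refine le_mul_of_one_le_left (norm_nonneg _) (Real.one_le_exp ?_)
      have h1 : b * (u / m k) ≤ 2 := by
        rw [← mul_div_assoc, div_le_iff₀ hmk]
        have := hu.2
        have := h.pos (n k)
        simp only [hm]
        nlinarith
      linarith
  -- This and the reverse bound hold for every finite set; on singletons they identify A' k with the
  -- norm of f k, up to constants.
  have hup : ∀ s : Finset ℕ, nuNorm p α (∑ k ∈ s, f k) ^ p ≤
      ENNReal.ofReal (C₁ * Real.exp 2 ^ p) * ENNReal.ofReal (∑ k ∈ s, A' k ^ p) := by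
    intro s
    refine (nuNorm_rpow_le hp0 hα _).trans ?_
    simp only [Finset.sum_apply, hfc]
    refine (hU c s).trans ?_
    rw [← ENNReal.ofReal_mul (by positivity), mul_assoc C₁, Finset.mul_sum s _ (Real.exp 2 ^ p)]
    refine ENNReal.ofReal_le_ofReal ?_
    gcongr with k _
    calc A k ^ p ≤ (Real.exp 2 * A' k) ^ p := Real.rpow_le_rpow (hA0 k) (hAA' k) hp0.le
      _ = _ := Real.mul_rpow (Real.exp_pos _).le (hA'0 k)
  have hlow : ∀ s : Finset ℕ, ENNReal.ofReal (∑ k ∈ s, A' k ^ p) ≤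
      ENNReal.ofReal C₂ * nuNorm p α (∑ k ∈ s, f k) ^ p := by
    intro s
    refine (hL c' s).trans (mul_le_mul_right ?_ _)
    refine le_trans (le_of_eq ?_) (le_nuNorm_rpow hp0 α _)
    congr 1
    ext x
    simp only [hc', expSum_shift, ← Finset.mul_sum, norm_mul, norm_ofReal_exp, Finset.sum_apply,
      hfc, hb]
  have hsum : ENNReal.ofReal (∑ k ∈ s, A' k ^ p) = ∑ k ∈ s, ENNReal.ofReal (A' k ^ p) :=
    ENNReal.ofReal_sum_of_nonneg fun k _ => Real.rpow_nonneg (hA'0 k) _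
  rw [ENNReal.ofReal_mul (by positivity)]
  constructor
  · refine (hup s).trans ?_
    rw [mul_assoc, hsum, Finset.mul_sum s _ (ENNReal.ofReal C₂)]
    gcongr with k _
    simpa using hlow {k}
  · calc _ ≤ ∑ k ∈ s, ENNReal.ofReal (C₁ * Real.exp 2 ^ p) * ENNReal.ofReal (A' k ^ p) := by
          gcongr with k _
          simpa using hup {k}
      _ = ENNReal.ofReal (C₁ * Real.exp 2 ^ p) * ENNReal.ofReal (∑ k ∈ s, A' k ^ p) := by
          rw [hsum, Finset.mul_sum]
      _ ≤ _ := by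
          rw [mul_assoc]
          gcongr
          exact hlow s

end IsQuasiLacunary
end QuasiLacunary

/-! ### Refinement of the blocks and the general finite case -/

lemma exists_mem_Ico_of_strictMono {φ : ℕ → ℕ} (hφ : StrictMono φ) (h0 : φ 0 = 0) (j : ℕ) :
    ∃ k, j ∈ Finset.Ico (φ k) (φ (k + 1)) := by
  have hex : ∃ k, j < φ (k + 1) := ⟨j, (Nat.lt_succ_self j).trans_le (hφ.le_apply)⟩
  classical
  refine ⟨Nat.find hex, Finset.mem_Ico.2 ⟨?_, Nat.find_spec hex⟩⟩
  rcases Nat.eq_zero_or_pos (Nat.find hex) with h | h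
  · rw [h, h0]; exact Nat.zero_le _
  · have := Nat.find_min hex (m := Nat.find hex - 1) (by omega)
    rw [Nat.sub_add_cancel h] at this
    exact not_lt.1 this

lemma eq_of_mem_Ico_of_strictMono {φ : ℕ → ℕ} (hφ : StrictMono φ) {j k l : ℕ}
    (hk : j ∈ Finset.Ico (φ k) (φ (k + 1))) (hl : j ∈ Finset.Ico (φ l) (φ (l + 1))) : k = l := by
  rw [Finset.mem_Ico] at hk hl
  have h1 := hφ.lt_iff_lt.1 (hk.1.trans_lt hl.2)
  have h2 := hφ.lt_iff_lt.1 (hl.1.trans_lt hk.2)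
  omega

namespace IsQuasiLacunary
variable {Λ : ℕ → ℝ} {n : ℕ → ℕ} {N : ℕ} {q : ℝ}

/-- A quasi-lacunary sequence can be cut into finer blocks whose exponents have bounded ratio. -/
lemma exists_refinement (h : IsQuasiLacunary Λ n N q) :
    ∃ n' φ : ℕ → ℕ, IsQuasiLacunary Λ n' N q ∧ StrictMono φ ∧ φ 0 = 0 ∧ (∀ k, n' (φ k) = n k) ∧
      ∀ k, ∀ μ ∈ expBlockFinset Λ n' k, μ ≤ q ^ N * Λ (n' k) := by
  classical
  have hq := h.one_lt
  set P : ℕ → Prop := fun j => j = 0 ∨ q * Λ (j - 1) ≤ Λ j with hP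
  have hPn : ∀ k, P (n k) := by
    intro k
    rcases k with _ | k
    · exact Or.inl h.cut_zero
    · have hlt : n k < n (k + 1) := h.cut_strictMono (Nat.lt_succ_self k)
      exact Or.inr (h.gap k _ ⟨n (k + 1) - 1, ⟨by omega, by omega⟩, rfl⟩ _
        ⟨n (k + 1), ⟨le_rfl, h.cut_strictMono (Nat.lt_succ_self _)⟩, rfl⟩)
  have hinf : (Set.ofPred P).Infinite :=
    (Set.infinite_range_of_injective h.cut_strictMono.injective).mono (by
      rintro _ ⟨k, rfl⟩; exact hPn k)
  set n' := Nat.nth P with hn'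
  have hmono : StrictMono n' := Nat.nth_strictMono hinf
  have hn'P : ∀ k, P (n' k) := Nat.nth_mem_of_infinite hinf
  have hn'0 : n' 0 = 0 := Nat.nth_zero_of_zero (Or.inl rfl)
  have hno : ∀ k j, n' k < j → j < n' (k + 1) → Λ j < q * Λ (j - 1) := by
    intro k j h1 h2
    by_contra! h3
    obtain ⟨i, -, hi⟩ := Nat.exists_lt_card_nth_eq (p := P) (x := j) (Or.inr h3)
    rw [← hi] at h1 h2
    have := hmono.lt_iff_lt.1 h1
    have := hmono.lt_iff_lt.1 h2
    omega
  set φ : ℕ → ℕ := fun k => Nat.count P (n k) with hφ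
  have hnφ : ∀ k, n' (φ k) = n k := fun k => Nat.nth_count (hPn k)
  have hφmono : StrictMono φ := fun a b hab =>
    Nat.count_strict_mono (hPn a) (h.cut_strictMono hab)
  have hφ0 : φ 0 = 0 := by simp [hφ, h.cut_zero]
  have hsub : ∀ k, ∃ l, n l ≤ n' k ∧ n' (k + 1) ≤ n (l + 1) := by
    intro k
    obtain ⟨l, hl⟩ := exists_mem_Ico_of_strictMono hφmono hφ0 k
    rw [Finset.mem_Ico] at hl
    refine ⟨l, ?_, ?_⟩
    · rw [← hnφ]; exact hmono.monotone hl.1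
    · rw [← hnφ]; exact hmono.monotone hl.2
  have hcardN : ∀ l, n (l + 1) - n l ≤ N := by
    intro l
    have := h.card_le l
    rwa [expBlock, Set.ncard_image_of_injective _ h.strictMono.injective, ← Finset.coe_Ico,
      Set.ncard_coe_finset, Nat.card_Ico] at this
  have hlen : ∀ k, n' (k + 1) - n' k ≤ N := by
    intro k
    obtain ⟨l, h1, h2⟩ := hsub k
    have := hcardN l
    omega
  refine ⟨n', φ, ⟨h.strictMono, h.pos, hn'0, hmono, ?_, hq, ?_⟩, hφmono, hφ0, hnφ, ?_⟩
  · intro k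
    rw [expBlock, Set.ncard_image_of_injective _ h.strictMono.injective, ← Finset.coe_Ico,
      Set.ncard_coe_finset, Nat.card_Ico]
    exact hlen k
  · rintro k _ ⟨i, hi, rfl⟩ _ ⟨j, hj, rfl⟩
    have hpos : 0 < n' (k + 1) := (Nat.zero_le _).trans_lt (hmono (Nat.lt_succ_self k))
    have h1 : q * Λ (n' (k + 1) - 1) ≤ Λ (n' (k + 1)) :=
      (hn'P (k + 1)).resolve_left (by omega)
    have h2 : Λ i ≤ Λ (n' (k + 1) - 1) := h.strictMono.monotone (by have := hi.2; omega)
    have h3 : Λ (n' (k + 1)) ≤ Λ j := h.strictMono.monotone hj.1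
    nlinarith
  · intro k μ hμ
    obtain ⟨j, hj, rfl⟩ := Finset.mem_image.1 hμ
    rw [Finset.mem_Ico] at hj
    have key : ∀ d, n' k + d < n' (k + 1) → Λ (n' k + d) ≤ q ^ d * Λ (n' k) := by
      intro d
      induction d with
      | zero => intro _; simp
      | succ d ih =>
        intro hd
        have h1 := hno k (n' k + (d + 1)) (by omega) hd
        rw [show n' k + (d + 1) - 1 = n' k + d by omega] at h1
        have h2 := ih (by omega)
        rw [pow_succ']
        nlinarith
    have h1 := key (j - n' k) (by omega)
    rw [Nat.add_sub_cancel' hj.1] at h1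
    refine h1.trans ?_
    have := h.pos (n' k)
    have := hlen k
    gcongr
    · exact hq.le
    · omega

lemma exists_sum_of_mem_blockSpace {𝕜 : Type*} [RCLike 𝕜] {n' φ : ℕ → ℕ} (hn' : StrictMono n')
    (hn'0 : n' 0 = 0) (hnφ : ∀ k, n' (φ k) = n k) {k : ℕ} {f : ℝ → 𝕜}
    (hf : f ∈ blockSpace 𝕜 Λ n k) :
    ∃ g : ℕ → ℝ → 𝕜, (∀ i, g i ∈ blockSpace 𝕜 Λ n' i) ∧
      ∑ i ∈ Finset.Ico (φ k) (φ (k + 1)), g i = f := by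
  have hle : blockSpace 𝕜 Λ n k ≤ ⨆ i ∈ Finset.Ico (φ k) (φ (k + 1)), blockSpace 𝕜 Λ n' i := by
    rw [blockSpace, Submodule.span_le]
    rintro _ ⟨_, ⟨j, hj, rfl⟩, rfl⟩
    obtain ⟨i, hi⟩ := exists_mem_Ico_of_strictMono hn' hn'0 j
    rw [Finset.mem_Ico] at hi
    rw [Set.mem_Ico, ← hnφ, ← hnφ] at hj
    have h1 := hn'.lt_iff_lt.1 (hj.1.trans_lt hi.2)
    have h2 := hn'.lt_iff_lt.1 (hi.1.trans_lt hj.2)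
    refine Submodule.mem_iSup_of_mem i (Submodule.mem_iSup_of_mem
      (Finset.mem_Ico.2 ⟨by omega, h2⟩) (Submodule.subset_span ⟨Λ j, ⟨j, hi, rfl⟩, rfl⟩))
  obtain ⟨g, hg⟩ := (Submodule.mem_iSup_finset_iff_exists_sum _ _).1 (hle hf)
  exact ⟨fun i => g i, fun i => (g i).2, hg⟩

/-- Decoupling of finite sums. -/
lemma exists_decoupling (𝕜 : Type*) [RCLike 𝕜] (h : IsQuasiLacunary Λ n N q) {p α : ℝ}
    (hp : 1 ≤ p) (hα : -1 < α) :
    ∃ C : ℝ, 0 < C ∧ ∀ f : ℕ → ℝ → 𝕜, (∀ k, f k ∈ blockSpace 𝕜 Λ n k) → ∀ s : Finset ℕ,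
      nuNorm p α (∑ k ∈ s, f k) ^ p ≤ ENNReal.ofReal C * ∑ k ∈ s, nuNorm p α (f k) ^ p ∧
      ∑ k ∈ s, nuNorm p α (f k) ^ p ≤ ENNReal.ofReal C * nuNorm p α (∑ k ∈ s, f k) ^ p := by
  classical
  obtain ⟨n', φ, h', hφ, hφ0, hnφ, hK⟩ := h.exists_refinement
  obtain ⟨C, hC0, hC⟩ := h'.exists_decoupling_of_ratio_le 𝕜 hK hp hα
  refine ⟨C * C, by positivity, fun f hf s => ?_⟩
  choose g hg hgf using fun k =>
    exists_sum_of_mem_blockSpace h'.cut_strictMono h'.cut_zero hnφ (hf k)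
  choose κ hκ using exists_mem_Ico_of_strictMono hφ hφ0
  set I : ℕ → Finset ℕ := fun k => Finset.Ico (φ k) (φ (k + 1)) with hI
  set G : ℕ → ℝ → 𝕜 := fun i => g (κ i) i with hG
  have hGf : ∀ k, ∑ i ∈ I k, G i = f k := by
    intro k
    rw [← hgf k]
    refine Finset.sum_congr rfl fun i hi => ?_
    simp only [hG, eq_of_mem_Ico_of_strictMono hφ (hκ i) hi]
  have hdisj : (s : Set ℕ).PairwiseDisjoint I := by
    intro k _ l _ hkl
    refine Finset.disjoint_left.2 fun i hi hj => hkl (eq_of_mem_Ico_of_strictMono hφ hi hj)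
  have hfine := hC G (fun i => hg (κ i) i)
  have hs := hfine (s.biUnion I)
  rw [Finset.sum_biUnion hdisj, Finset.sum_biUnion hdisj] at hs
  simp only [hGf] at hs
  have hk := fun k => hfine (I k)
  simp only [hGf] at hk
  rw [ENNReal.ofReal_mul hC0.le, mul_assoc, mul_assoc]
  constructor
  · refine hs.1.trans (mul_le_mul_right ?_ _)
    rw [Finset.mul_sum]
    gcongr with k _
    exact (hk k).2
  · calc _ ≤ ENNReal.ofReal C * ∑ k ∈ s, ∑ i ∈ I k, nuNorm p α (G i) ^ p := by
          rw [Finset.mul_sum]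
          gcongr with k _
          exact (hk k).1
      _ ≤ _ := by
          gcongr
          exact hs.2

end IsQuasiLacunary

section Norms
variable {𝕜 : Type*} [RCLike 𝕜] {Λ : ℕ → ℝ} {n : ℕ → ℕ}

lemma measurable_of_mem_blockSpace {k : ℕ} {f : ℝ → 𝕜} (hf : f ∈ blockSpace 𝕜 Λ n k) :
    Measurable f := by
  obtain ⟨c, hc⟩ := exists_expSum_of_mem_blockSpace hf
  rw [funext hc]
  refine Finset.measurable_fun_sum _ fun μ _ => ?_
  exact measurable_const.mul (RCLike.measurable_ofReal.comp (by fun_prop))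

lemma le_ofReal_mul_rpow_one_div {p C : ℝ} (hp : 0 < p) (hC : 0 < C) {X S : ℝ≥0∞}
    (h : X ^ p ≤ ENNReal.ofReal C * S) :
    X ≤ ENNReal.ofReal (C ^ (1 / p)) * S ^ (1 / p) := by
  have := ENNReal.rpow_le_rpow h (z := 1 / p) (by positivity)
  rwa [← ENNReal.rpow_mul, mul_one_div_cancel hp.ne', ENNReal.rpow_one,
    ENNReal.mul_rpow_of_nonneg _ _ (by positivity), ENNReal.ofReal_rpow_of_pos hC] at this

lemma ofReal_mul_rpow_one_div_le {p C : ℝ} (hp : 0 < p) (hC : 0 < C) {X S : ℝ≥0∞}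
    (h : S ≤ ENNReal.ofReal C * X ^ p) :
    ENNReal.ofReal (C ^ (1 / p))⁻¹ * S ^ (1 / p) ≤ X := by
  have hC' : 0 < C ^ (1 / p) := by positivity
  have := ENNReal.rpow_le_rpow h (z := 1 / p) (by positivity)
  rw [ENNReal.mul_rpow_of_nonneg _ _ (by positivity), ← ENNReal.rpow_mul,
    mul_one_div_cancel hp.ne', ENNReal.rpow_one, ENNReal.ofReal_rpow_of_pos hC] at this
  calc _ ≤ ENNReal.ofReal (C ^ (1 / p))⁻¹ * (ENNReal.ofReal (C ^ (1 / p)) * X) := by gcongr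
    _ = X := by
      rw [← mul_assoc, ← ENNReal.ofReal_mul (by positivity), inv_mul_cancel₀ hC'.ne',
        ENNReal.ofReal_one, one_mul]

lemma nuNorm_add_le {p α : ℝ} (hp : 1 ≤ p) {f g : ℝ → 𝕜}
    (hf : AEStronglyMeasurable f (nuMeasure α)) (hg : AEStronglyMeasurable g (nuMeasure α)) :
    nuNorm p α (f + g) ≤ nuNorm p α f + nuNorm p α g :=
  eLpNorm_add_le hf hg (by simpa using hp)

/-- A series in `L^p` whose finite partial sums satisfy an upper `p`-estimate converges as soon
as the sum of the `p`-th powers of the norms is finite. -/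
lemma exists_tendsto_of_tsum_ne_top {p α C : ℝ} (hp : 1 ≤ p) (hC : 0 < C) {f : ℕ → ℝ → 𝕜}
    (hf : ∀ k, AEStronglyMeasurable (f k) (nuMeasure α))
    (hup : ∀ s : Finset ℕ,
      nuNorm p α (∑ k ∈ s, f k) ^ p ≤ ENNReal.ofReal C * ∑ k ∈ s, nuNorm p α (f k) ^ p)
    (hfin : ∑' k, nuNorm p α (f k) ^ p ≠ ∞) :
    ∃ g : ℝ → 𝕜, MemLp g (ENNReal.ofReal p) (nuMeasure α) ∧
      Tendsto (fun K => nuNorm p α ((∑ k ∈ Finset.range K, f k) - g)) atTop (𝓝 0) := by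
  have hp0 : 0 < p := by linarith
  have : Fact (1 ≤ ENNReal.ofReal p) := ⟨by simpa using hp⟩
  have hne : ∀ k, nuNorm p α (f k) ^ p ≠ ∞ := ENNReal.ne_top_of_tsum_ne_top hfin
  have hmem : ∀ k, MemLp (f k) (ENNReal.ofReal p) (nuMeasure α) := by
    refine fun k => ⟨hf k, lt_top_iff_ne_top.2 fun htop => hne k ?_⟩
    rw [nuNorm, htop, ENNReal.top_rpow_of_pos hp0]
  have hmems : ∀ s : Finset ℕ, MemLp (∑ k ∈ s, f k) (ENNReal.ofReal p) (nuMeasure α) :=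
    fun s => memLp_finsetSum' s fun k _ => hmem k
  have htoLp : ∀ s : Finset ℕ, ∑ k ∈ s, (hmem k).toLp (f k) = (hmems s).toLp _ := by
    intro s
    induction s using Finset.induction_on with
    | empty => simp
    | insert a s ha ih =>
      rw [Finset.sum_insert ha, ih, ← MemLp.toLp_add]
      exact MemLp.toLp_congr _ _ (by rw [Finset.sum_insert ha])
  have hsum : Summable fun k => (hmem k).toLp (f k) := by
    rw [summable_iff_vanishing_norm]
    intro ε hε
    obtain ⟨s, hs⟩ := summable_iff_vanishing_norm.1 (ENNReal.summable_toReal hfin)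
      (ε ^ p / C) (by positivity)
    refine ⟨s, fun t ht => ?_⟩
    have h1 := (le_abs_self _).trans_lt (hs t ht)
    rw [htoLp, Lp.norm_toLp]
    rw [← ENNReal.toReal_sum fun k _ => hne k, lt_div_iff₀ hC] at h1
    have h2 : ((nuNorm p α (∑ k ∈ t, f k)).toReal) ^ p ≤
        C * (∑ k ∈ t, nuNorm p α (f k) ^ p).toReal := by
      have hfin' : ∑ k ∈ t, nuNorm p α (f k) ^ p ≠ ∞ := ENNReal.sum_ne_top.2 fun k _ => hne k
      have := ENNReal.toReal_mono (ENNReal.mul_ne_top ENNReal.ofReal_ne_top hfin') (hup t)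
      rwa [← ENNReal.toReal_rpow, ENNReal.toReal_mul, ENNReal.toReal_ofReal hC.le] at this
    refine (Real.rpow_lt_rpow_iff ENNReal.toReal_nonneg hε.le hp0).1 ?_
    change ((nuNorm p α (∑ k ∈ t, f k)).toReal) ^ p < ε ^ p
    linarith
  obtain ⟨G, hG⟩ := hsum
  refine ⟨G, Lp.memLp G, ?_⟩
  have ht := hG.tendsto_sum_nat
  simp only [htoLp] at ht
  exact (Lp.tendsto_Lp_iff_tendsto_eLpNorm'' _ (fun K => hmems (Finset.range K)) G
    (Lp.memLp G)).1 (by rwa [Lp.toLp_coeFn])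

end Norms

theorem mainTheorem3 {𝕜 : Type*} [RCLike 𝕜] (Λ : ℕ → ℝ) (n : ℕ → ℕ) (N : ℕ) (q : ℝ)
    (hΛ : IsQuasiLacunary Λ n N q) (p : ℝ) (hp : 1 ≤ p) (α : ℝ) (hα : -1 < α) :
    ∃ C₁ C₂ : ℝ, 0 < C₁ ∧ 0 < C₂ ∧
      ∀ f : ℕ → ℝ → 𝕜, (∀ k, f k ∈ blockSpace 𝕜 Λ n k) →
        -- finite sums
        (∀ s : Finset ℕ,
          ENNReal.ofReal C₁ * (∑ k ∈ s, nuNorm p α (f k) ^ p) ^ (1 / p)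
              ≤ nuNorm p α (∑ k ∈ s, f k) ∧
            nuNorm p α (∑ k ∈ s, f k)
              ≤ ENNReal.ofReal C₂ * (∑ k ∈ s, nuNorm p α (f k) ^ p) ^ (1 / p)) ∧
        -- infinite sums converging in the norm
        (∀ g : ℝ → 𝕜, AEStronglyMeasurable g (nuMeasure α) →
          Tendsto (fun K => nuNorm p α ((∑ k ∈ Finset.range K, f k) - g)) atTop (𝓝 0) →
          ENNReal.ofReal C₁ * (∑' k, nuNorm p α (f k) ^ p) ^ (1 / p) ≤ nuNorm p α g ∧
            nuNorm p α g ≤ ENNReal.ofReal C₂ * (∑' k, nuNorm p α (f k) ^ p) ^ (1 / p)) ∧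
        -- the series converges in the norm as soon as the right-hand side is finite
        (∑' k, nuNorm p α (f k) ^ p ≠ ∞ →
          ∃ g : ℝ → 𝕜, MemLp g (ENNReal.ofReal p) (nuMeasure α) ∧
            Tendsto (fun K => nuNorm p α ((∑ k ∈ Finset.range K, f k) - g)) atTop (𝓝 0)) := by
  have hp0 : 0 < p := by linarith
  obtain ⟨C, hC0, hC⟩ := hΛ.exists_decoupling 𝕜 hp hα
  refine ⟨(C ^ (1 / p))⁻¹, C ^ (1 / p), by positivity, by positivity, fun f hf => ?_⟩
  have hfm : ∀ k, AEStronglyMeasurable (f k) (nuMeasure α) := fun k =>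
    (measurable_of_mem_blockSpace (hf k)).aestronglyMeasurable
  have hfin : ∀ s : Finset ℕ, nuNorm p α (∑ k ∈ s, f k) ≤
      ENNReal.ofReal (C ^ (1 / p)) * (∑ k ∈ s, nuNorm p α (f k) ^ p) ^ (1 / p) := fun s =>
    le_ofReal_mul_rpow_one_div hp0 hC0 (hC f hf s).1
  refine ⟨fun s => ⟨ofReal_mul_rpow_one_div_le hp0 hC0 (hC f hf s).2, hfin s⟩, ?_,
    exists_tendsto_of_tsum_ne_top hp hC0 hfm fun s => (hC f hf s).1⟩
  intro g hg hlim
  set S : ℕ → ℝ → 𝕜 := fun K => ∑ k ∈ Finset.range K, f k with hS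
  have hSm : ∀ K, AEStronglyMeasurable (S K) (nuMeasure α) := fun K =>
    Finset.aestronglyMeasurable_sum _ fun k _ => hfm k
  constructor
  · refine ofReal_mul_rpow_one_div_le hp0 hC0 ?_
    have h1 : ∀ K, ∑ k ∈ Finset.range K, nuNorm p α (f k) ^ p ≤
        ENNReal.ofReal C * (nuNorm p α (S K - g) + nuNorm p α g) ^ p := by
      intro K
      refine (hC f hf _).2.trans ?_
      gcongr
      simpa using nuNorm_add_le hp ((hSm K).sub hg) hg
    have h2 : Tendsto (fun K => ENNReal.ofReal C * (nuNorm p α (S K - g) + nuNorm p α g) ^ p)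
        atTop (𝓝 (ENNReal.ofReal C * (0 + nuNorm p α g) ^ p)) :=
      ENNReal.Tendsto.const_mul
        ((ENNReal.continuous_rpow_const.tendsto _).comp (hlim.add tendsto_const_nhds))
        (Or.inr ENNReal.ofReal_ne_top)
    rw [zero_add] at h2
    exact le_of_tendsto_of_tendsto' (ENNReal.tendsto_nat_tsum _) h2 h1
  · set X := ENNReal.ofReal (C ^ (1 / p)) * (∑' k, nuNorm p α (f k) ^ p) ^ (1 / p) with hX
    have h1 : ∀ K, nuNorm p α g ≤ nuNorm p α (S K - g) + X := by
      intro K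
      have h2 : nuNorm p α g ≤ nuNorm p α (g - S K) + nuNorm p α (S K) := by
        simpa using nuNorm_add_le hp (hg.sub (hSm K)) (hSm K)
      have h3 : nuNorm p α (g - S K) = nuNorm p α (S K - g) := eLpNorm_sub_comm _ _ _ _
      rw [h3] at h2
      refine h2.trans ?_
      gcongr
      refine (hfin _).trans ?_
      rw [hX]
      gcongr
      exact ENNReal.sum_le_tsum _
    have h2 : Tendsto (fun K => nuNorm p α (S K - g) + X) atTop (𝓝 (0 + X)) :=
      hlim.add tendsto_const_nhds
    rw [zero_add] at h2
    exact ge_of_tendsto' h2 h1
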